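/- **Conventions.** Let $\mathsf T$ be a triangulated category with shift $\Sigma$ and small coproducts, $\mathsf T^c$ its full subcategory of compact objects. For full subcategories, $\mathsf X^\perp$ and ${}^\perp\mathsf X$ are the right and left orthogonals in $\mathsf T$; $\mathsf X\star\mathsf Y$ consists of the $F$ in a triangle $X\to F\to Y\to\Sigma X$ with $X\in\mathsf X$, $Y\in\mathsf Y$; $\operatorname{Coprod}(\mathsf X)$ is the closure of $\mathsf X$ under small coproducts and extensions, $\operatorname{coprod}(\mathsf X)$ that under finite coproducts and extensions, $\operatorname{smd}$ the closure under direct summands. A strictly full triangulated subcategory is *right* (*left*) *admissible* if its inclusion has a right (left) adjoint, and *admissible* if both hold. A *semiorthogonal decomposition* $\langle\mathsf U_1,\dots,\mathsf U_n\rangle$ of a triangulated category $\mathsf S$ is a sequence of strictly full triangulated subcategories with $\operatorname{Hom}(\mathsf U_i,\mathsf U_j)=0$ for $i>j$ such that no strictly full triangulated subcategory other than $\mathsf S$ contains all $\mathsf U_i$. An *extended good metric* on a triangulated category is a decreasing sequence $\{\mathcal M_n\}_{n\in\mathbb Z}$ of strictly full subcategories, each closed under extensions and containing $0$, with $\Sigma^{\pm1}\mathcal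 M_{n+1}\subseteq\mathcal M_n$. It is *orthogonal* if ${}^\perp[(\mathcal M_n)^\perp]=\mathcal M_n$ for all $n$; *compressed* if for every triangulated endofunctor $F$ and every $i$ there is $n$ with $F(\mathcal M_n)\subseteq\mathcal M_i$; *$\mathbb N$-compressed* if for every triangulated endofunctor $F$ there is $l\ge 0$ with $F(\mathcal M_{i+l})\subseteq\mathcal M_i$ for all $i$; and *equivalent* to $\mathcal N$ if for all $i$ there is $j\geq 0$ with $\mathcal M_{i+j}\subseteq\mathcal N_i\subseteq\mathcal M_{i-j}$. Let $\mathsf T$ be compactly generated. A *generating sequence* is a sequence $\mathcal G=\{\mathcal G^n\}_{n\in\mathbb Z}$ of full subcategories of $\mathsf T^c$ with $\operatorname{smd}(\operatorname{coprod}(\bigcup_n\mathcal G^n))=\mathsf T^c$ and $\Sigma^{-1}\mathcal G^n\cup\mathcal G^n\cup\Sigma\mathcal G^n\subseteq\operatorname{smd}(\operatorname{coprod}(\bigcup_{|i-n|\le1}\mathcal G^i))$ for all $n$. Put $\mathcal M^{\mathcal G}_n=\operatorname{smd}(\operatorname{coprod}(\bigcup_{i\le-n}\mathcal G^i))$ and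 $\mathcal R^{\mathcal G}_n={}^\perp[(\mathcal M^{\mathcal G}_n)^\perp]$. The sequence $\mathcal G$ is *$\mathbb N$-compressed* if every $\mathcal G^n$ consists of finitely many objects up to isomorphism, $\mathcal R^{\mathcal G}\cap\mathsf T^c$ is an $\mathbb N$-compressed metric on $\mathsf T^c$, and it is equivalent to $\mathcal M^{\mathcal G}$. For an orthogonal metric $\mathcal R$ on $\mathsf T$ put $\overline{\mathsf T^c}=\bigcap_n\mathsf T^c\star\mathcal R_n$, $\mathcal G^\perp=\bigcup_n(\mathcal M^{\mathcal G}_n)^\perp$ and $\mathsf T^b_c=\overline{\mathsf T^c}\cap\mathcal G^\perp$. **Theorem.** 1. Let $\mathsf T$ be compactly generated, with an $\mathbb N$-compressed generating sequence $\mathcal G$ and an orthogonal metric $\mathcal R$ such that the metric $\mathcal R\cap\mathsf T^c$ on $\mathsf T^c$ is compressed (which is automatic for $\mathcal R=\mathcal R^{\mathcal G}$) and such that for every $n\in\mathbb Z$ one has $\operatorname{Hom}(\mathcal G^n,\mathcal R_i)=0$ for all $i\gg0$. Then, for every admissible subcategory $\mathsf A$ of $\mathsf T^c$, $\mathsf T^b_c$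 is a triangulated subcategory of $\mathsf T$ and $\operatorname{Coprod}(\mathsf A)\cap\mathsf T^b_c$ is a right admissible subcategory of $\mathsf T^b_c$. 2. Let $\mathsf T$ have a single compact generator $G$ with $\operatorname{Hom}(G,\Sigma^nG)=0$ for $n\gg0$. * For every admissible subcategory $\mathsf A$ of $\mathsf T^c$, $\operatorname{Coprod}(\mathsf A)\cap\mathsf T^b_c$ is right admissible in the triangulated category $\mathsf T^b_c$, formed with $\mathcal G^n=\{\Sigma^{-n}G\}$ and $\mathcal R=\mathcal R^{\mathcal G}$. * Let $\mathsf T_G^{\le0}=\operatorname{Coprod}(\{\Sigma^iG:i\ge0\})$, $\mathsf T^-_c=\bigcap_n\mathsf T^c\star\Sigma^n\mathsf T_G^{\le0}$ and ${}^{\mathrm I}\mathsf T^b_c=\{F\in\mathsf T^-_c:\operatorname{Hom}(\Sigma^iG,F)=0\text{ for }i\gg0\}$. If $\langle\mathsf A,\mathsf B\rangle$ is a semiorthogonal decomposition of $\mathsf T^c$ with $\mathsf B$ admissible, then $\langle\operatorname{Coprod}(\mathsf A)\cap{}^{\mathrm I}\mathsf T^b_c,\ \operatorname{Coprod}(\mathsf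 B)\cap{}^{\mathrm I}\mathsf T^b_c\rangle$ is a semiorthogonal decomposition of the triangulated category ${}^{\mathrm I}\mathsf T^b_c$. 3. Let $\mathsf T$ have a single compact generator $G$ with $\operatorname{Hom}(G,\Sigma^nG)=0$ for $n\ll0$. * For every admissible subcategory $\mathsf A$ of $\mathsf T^c$, $\operatorname{Coprod}(\mathsf A)\cap\mathsf T^b_c$ is right admissible in the triangulated category $\mathsf T^b_c$, formed with $\mathcal G^n=\{\Sigma^{n}G\}$ and $\mathcal R=\mathcal R^{\mathcal G}$. * Let $\mathsf V_G=(\{\Sigma^iG:i\le0\})^\perp$, $\mathsf U_G={}^\perp(\Sigma\mathsf V_G)$, $\mathsf T^+_c=\bigcap_n\mathsf T^c\star\Sigma^{-n}\mathsf U_G$ and ${}^{\mathrm{II}}\mathsf T^b_c=\{F\in\mathsf T^+_c:\operatorname{Hom}(\Sigma^iG,F)=0\text{ for }i\ll0\}$. If $\langle\mathsf A,\mathsf B\rangle$ is a semiorthogonal decomposition of $\mathsf T^c$ with $\mathsf B$ admissible, then $\langle\operatorname{Coprod}(\mathsf A)\cap{}^{\mathrm{II}}\mathsf T^b_c,\ \operatorname{Coprod}(\mathsf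 B)\cap{}^{\mathrm{II}}\mathsf T^b_c\rangle$ is a semiorthogonal decomposition of the triangulated category ${}^{\mathrm{II}}\mathsf T^b_c$. -/

import Mathlib

open CategoryTheory CategoryTheory.Limits CategoryTheory.Pretriangulated
open scoped ZeroObject

universe v u

namespace TriMetric

section Closures

variable {C : Type u} [Category.{v} C] [HasZeroObject C] [HasShift C ℤ] [Preadditive C]
  [∀ n : ℤ, (shiftFunctor C n).Additive] [Pretriangulated C]

/-- `Coprod(P)`: the closure of `P` under (small) coproducts and extensions. -/
inductive coprodClosure (P : ObjectProperty C) : C → Prop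
  | of (X : C) (h : P X) : coprodClosure P X
  | coproduct {J : Type v} (Y : J → C) (c : Cofan Y) (hc : IsColimit c)
      (h : ∀ j, coprodClosure P (Y j)) : coprodClosure P c.pt
  | extension (D : Triangle C) (hD : D ∈ distTriang C)
      (h₁ : coprodClosure P D.obj₁) (h₃ : coprodClosure P D.obj₃) : coprodClosure P D.obj₂

/-- `coprod(P)`: the closure of `P` under finite coproducts and extensions. -/
inductive finiteCoprodClosure (P : ObjectProperty C) : C → Prop
  | of (X : C) (h : P X) : finiteCoprodClosure P X
  | coproduct {J : Type} [Finite J] (Y : J → C) (c : Cofan Y) (hc : IsColimit c)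
      (h : ∀ j, finiteCoprodClosure P (Y j)) : finiteCoprodClosure P c.pt
  | extension (D : Triangle C) (hD : D ∈ distTriang C)
      (h₁ : finiteCoprodClosure P D.obj₁) (h₃ : finiteCoprodClosure P D.obj₃) :
      finiteCoprodClosure P D.obj₂

/-- `smd(coprod(P))`. -/
def smdCoprod (P : ObjectProperty C) : ObjectProperty C :=
  ObjectProperty.retractClosure (finiteCoprodClosure P)

end Closures

section Compact

variable (C : Type u) [Category.{v} C] [HasZeroObject C] [HasShift C ℤ] [Preadditive C]
  [∀ n : ℤ, (shiftFunctor C n).Additive] [Pretriangulated C]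

/-- The compact objects: `X` such that, for every small family `Y` with a coproduct, every map
`X ⟶ ∐ Y` is a finite sum of maps `X ⟶ Y j ⟶ ∐ Y`. This says that the canonical map
`⨁ j, Hom(X, Y j) → Hom(X, ∐ Y)` is surjective; it is always injective, since each `Y j` is a
direct summand of the coproduct. -/
def compacts : ObjectProperty C := fun X =>
  ∀ ⦃J : Type v⦄ (Y : J → C) (c : Cofan Y) (_ : IsColimit c) (f : X ⟶ c.pt),
    ∃ (s : Finset J) (g : ∀ j, X ⟶ Y j), f = ∑ j ∈ s, g j ≫ c.inj j

instance : (compacts C).IsClosedUnderIsomorphisms where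
  of_iso {X X'} e hX J Y c hc f := by
    obtain ⟨s, g, hg⟩ := hX Y c hc (e.hom ≫ f)
    refine ⟨s, fun j => e.inv ≫ g j, ?_⟩
    rw [← cancel_epi e.hom, hg, Preadditive.comp_sum]
    simp

instance : (compacts C).IsTriangulated where
  exists_zero := ⟨0, isZero_zero C, fun J Y c hc f => ⟨∅, fun _ => 0, by
    simpa using (isZero_zero C).eq_of_src f 0⟩⟩
  isStableUnderShiftBy n := ⟨fun X hX J Y c hc f => by
    let hc' := isColimitCofanMkObjOfIsColimit (shiftFunctor C (-n)) Y c.inj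
      (hc.ofIsoColimit (Cofan.ext (Iso.refl _)))
    obtain ⟨s, g, hg⟩ := hX _ _ hc' ((shiftShiftNeg X n).inv ≫ f⟦-n⟧')
    choose p hp using fun j => (shiftFunctor C (-n)).map_surjective
      ((shiftShiftNeg X n).hom ≫ g j)
    refine ⟨s, p, (shiftFunctor C (-n)).map_injective ?_⟩
    rw [← cancel_epi (shiftShiftNeg X n).inv, hg, Functor.map_sum, Preadditive.comp_sum]
    refine Finset.sum_congr rfl fun j _ => ?_
    rw [Functor.map_comp, hp, Category.assoc]
    exact (Iso.inv_hom_id_assoc (shiftShiftNeg X n) _).symm⟩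
  toIsTriangulatedClosed₂ := .mk' fun T hT h₁ h₃ J Y c hc f => by
    classical
    obtain ⟨s, g, hg⟩ := h₁ Y c hc (T.mor₁ ≫ f)
    let π : ∀ j, c.pt ⟶ Y j := fun j =>
      Cofan.IsColimit.desc hc (fun i => if h : i = j then eqToHom (by rw [h]) else 0)
    have hπ : ∀ i j, c.inj i ≫ π j = if h : i = j then eqToHom (by rw [h]) else 0 :=
      fun i j => Cofan.IsColimit.fac hc _ i
    have key : T.mor₁ ≫ (f - f ≫ ∑ j ∈ s, π j ≫ c.inj j) = 0 := by
      rw [Preadditive.comp_sub, reassoc_of% hg, hg, sub_eq_zero, Preadditive.sum_comp]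
      refine Finset.sum_congr rfl fun i hi => ?_
      rw [Category.assoc, Preadditive.comp_sum, Finset.sum_eq_single_of_mem i hi]
      · rw [← Category.assoc (c.inj i), hπ]
        simp
      · intro j _ hj
        rw [← Category.assoc, hπ, dif_neg (Ne.symm hj), zero_comp]
    obtain ⟨q, hq⟩ := Triangle.yoneda_exact₂ T hT _ key
    obtain ⟨t, k, hk⟩ := h₃ Y c hc q
    have ext : ∀ (r : Finset J) (m : ∀ j, T.obj₂ ⟶ Y j), r ⊆ s ∪ t →
        ∑ j ∈ r, m j ≫ c.inj j = ∑ j ∈ s ∪ t, (if j ∈ r then m j else 0) ≫ c.inj j := by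
      intro r m hr
      rw [← Finset.sum_subset hr (fun j _ hj => by rw [if_neg hj, zero_comp])]
      exact Finset.sum_congr rfl fun j hj => by rw [if_pos hj]
    refine ⟨s ∪ t, fun j => (if j ∈ t then T.mor₂ ≫ k j else 0) +
      (if j ∈ s then f ≫ π j else 0), ?_⟩
    rw [sub_eq_iff_eq_add] at hq
    simp only [Preadditive.add_comp, Finset.sum_add_distrib]
    rw [← ext t _ Finset.subset_union_right, ← ext s _ Finset.subset_union_left]
    refine hq.trans ?_
    rw [hk]
    simp only [Preadditive.comp_sum, Category.assoc]

end Compact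

section Subcategories

variable {C : Type u} [Category.{v} C] [HasZeroObject C] [HasShift C ℤ] [Preadditive C]
  [∀ n : ℤ, (shiftFunctor C n).Additive] [Pretriangulated C]

/-- `U` is a strictly full triangulated subcategory of `C`. -/
structure IsStrictTriangulated (U : ObjectProperty C) : Prop where
  strict : U.IsClosedUnderIsomorphisms
  triangulated : U.IsTriangulated

/-- Right admissible: a strictly full triangulated subcategory whose inclusion has a right
adjoint. -/
structure IsRightAdmissible (U : ObjectProperty C) : Prop extends IsStrictTriangulated U where
  hasRightAdjoint : U.ι.IsLeftAdjoint

/-- Left admissible: a strictly full triangulated subcategory whose inclusion has a left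
adjoint. -/
structure IsLeftAdmissible (U : ObjectProperty C) : Prop extends IsStrictTriangulated U where
  hasLeftAdjoint : U.ι.IsRightAdjoint

/-- Admissible: both left and right admissible. -/
def IsAdmissible (U : ObjectProperty C) : Prop := IsLeftAdmissible U ∧ IsRightAdmissible U

/-- A semiorthogonal decomposition `⟨U 0, …, U (n - 1)⟩` of `C`. -/
structure IsSemiorthogonalDecomposition {n : ℕ} (U : Fin n → ObjectProperty C) : Prop where
  strictTriangulated : ∀ i, IsStrictTriangulated (U i)
  hom_eq_zero : ∀ i j, j < i → ∀ ⦃X Y : C⦄ (f : X ⟶ Y), U i X → U j Y → f = 0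
  generates : ∀ P : ObjectProperty C, IsStrictTriangulated P → (∀ i, U i ≤ P) → P = ⊤

/-- `S` is a triangulated subcategory of `C`, and `U` is contained in `S` and is right admissible
in the triangulated category `S`. -/
def IsRightAdmissibleIn (U S : ObjectProperty C) : Prop :=
  U ≤ S ∧ ∃ _ : S.IsTriangulated, IsRightAdmissible (U.inverseImage S.ι)

/-- `S` is a triangulated subcategory of `C`, and `U` is contained in `S` and is admissible
in the triangulated category `S`. -/
def IsAdmissibleIn (U S : ObjectProperty C) : Prop :=
  U ≤ S ∧ ∃ _ : S.IsTriangulated, IsAdmissible (U.inverseImage S.ι)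

/-- `S` is a triangulated subcategory of `C`, the `U i` are contained in `S` and form a
semiorthogonal decomposition of the triangulated category `S`. -/
def IsSemiorthogonalDecompositionIn {n : ℕ} (U : Fin n → ObjectProperty C)
    (S : ObjectProperty C) : Prop :=
  (∀ i, U i ≤ S) ∧
    ∃ _ : S.IsTriangulated, IsSemiorthogonalDecomposition fun i => (U i).inverseImage S.ι

end Subcategories

section Metrics

variable {C : Type u} [Category.{v} C] [HasZeroObject C] [HasShift C ℤ] [Preadditive C]
  [∀ n : ℤ, (shiftFunctor C n).Additive] [Pretriangulated C]

/-- Extended good metrics. -/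
structure IsExtendedGoodMetric (M : ℤ → ObjectProperty C) : Prop where
  strict : ∀ n, (M n).IsClosedUnderIsomorphisms
  containsZero : ∀ n, (M n).ContainsZero
  extension : ∀ n, ∀ D ∈ distTriang C, M n D.obj₁ → M n D.obj₃ → M n D.obj₂
  succ_le : ∀ n, M (n + 1) ≤ M n
  shift_one : ∀ n X, M (n + 1) X → M n (X⟦(1 : ℤ)⟧)
  shift_neg_one : ∀ n X, M (n + 1) X → M n (X⟦(-1 : ℤ)⟧)

/-- Orthogonal metrics: extended good metrics `R` with `⊥((R n)⊥) = R n` for all `n`. -/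
structure IsOrthogonalMetric (R : ℤ → ObjectProperty C) : Prop extends IsExtendedGoodMetric R where
  orthogonal : ∀ n, (R n).rightOrthogonal.leftOrthogonal = R n

/-- Equivalence of the metrics `M` and `N`. -/
def MetricEquivalent (M N : ℤ → ObjectProperty C) : Prop :=
  ∀ i : ℤ, ∃ j : ℕ, M (i + j) ≤ N i ∧ N i ≤ M (i - j)

/-- Compressed metrics: every triangulated endofunctor is a compression functor. -/
structure IsCompressedMetric (M : ℤ → ObjectProperty C) : Prop extends IsExtendedGoodMetric M where
  compressed : ∀ (F : C ⥤ C) [F.CommShift ℤ] [F.IsTriangulated],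
    ∀ i : ℤ, ∃ n : ℤ, ∀ X, M n X → M i (F.obj X)

/-- `ℕ`-compressed metrics: for every triangulated endofunctor the loss is bounded by a constant
`l`. -/
structure IsNCompressedMetric (M : ℤ → ObjectProperty C) : Prop extends IsExtendedGoodMetric M where
  compressed : ∀ (F : C ⥤ C) [F.CommShift ℤ] [F.IsTriangulated],
    ∃ l : ℕ, ∀ i : ℤ, ∀ X, M (i + l) X → M i (F.obj X)

end Metrics

section Generating

variable {T : Type u} [Category.{v} T] [HasZeroObject T] [HasShift T ℤ] [Preadditive T]
  [∀ n : ℤ, (shiftFunctor T n).Additive] [Pretriangulated T]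

variable (T) in
/-- `T` has small coproducts and is generated by a (small) set of compact objects. -/
def IsCompactlyGenerated : Prop :=
  HasCoproducts.{v} T ∧ ∃ (ι : Type v) (S : ι → T), (∀ i, compacts T (S i)) ∧
    ∀ X : T, (∀ (i : ι) (n : ℤ) (f : (S i)⟦n⟧ ⟶ X), f = 0) → IsZero X

/-- `T` has small coproducts and `G` is a single compact generator. -/
def IsCompactGenerator (G : T) : Prop :=
  HasCoproducts.{v} T ∧ compacts T G ∧
    ∀ X : T, (∀ (n : ℤ) (f : G⟦n⟧ ⟶ X), f = 0) → IsZero X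

/-- `𝒢^I = smd(coprod(⋃_{i ∈ I} 𝒢^i))` for a set `I` of integers, for instance an interval. -/
def seqSpan (𝒢 : ℤ → ObjectProperty T) (I : Set ℤ) : ObjectProperty T :=
  smdCoprod fun X => ∃ i ∈ I, 𝒢 i X

/-- Generating sequences of (full subcategories of) compact objects. -/
structure IsGeneratingSequence (𝒢 : ℤ → ObjectProperty T) : Prop where
  le_compacts : ∀ n, 𝒢 n ≤ compacts T
  span_eq : seqSpan 𝒢 Set.univ = compacts T
  le_span : ∀ n, 𝒢 n ≤ seqSpan 𝒢 (Set.Icc (n - 1) (n + 1))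
  shift_one : ∀ n X, 𝒢 n X → seqSpan 𝒢 (Set.Icc (n - 1) (n + 1)) (X⟦(1 : ℤ)⟧)
  shift_neg_one : ∀ n X, 𝒢 n X → seqSpan 𝒢 (Set.Icc (n - 1) (n + 1)) (X⟦(-1 : ℤ)⟧)

/-- Every `𝒢^n` consists of finitely many objects (up to isomorphism). -/
def IsFiniteSequence (𝒢 : ℤ → ObjectProperty T) : Prop :=
  ∀ n, ∃ s : Set T, s.Finite ∧ ∀ X, 𝒢 n X → ∃ Y ∈ s, 𝒢 n Y ∧ Nonempty (X ≅ Y)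

/-- `ℳ^𝒢_n = 𝒢^{(-∞, -n]}`. -/
def metricM (𝒢 : ℤ → ObjectProperty T) (n : ℤ) : ObjectProperty T := seqSpan 𝒢 (Set.Iic (-n))

/-- `ℛ^𝒢_n = ⊥((ℳ^𝒢_n)⊥)`, the orthogonals being taken in `T`. -/
def metricR (𝒢 : ℤ → ObjectProperty T) (n : ℤ) : ObjectProperty T :=
  (metricM 𝒢 n).rightOrthogonal.leftOrthogonal

/-- The restriction `{R n ∩ T^c}` to `T^c` of a family of full subcategories of `T`. -/
def onCompacts (R : ℤ → ObjectProperty T) (n : ℤ) :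
    ObjectProperty (compacts T).FullSubcategory :=
  (R n).inverseImage (compacts T).ι

/-- `ℕ`-compressed generating sequences. -/
structure IsNCompressedGeneratingSequence (𝒢 : ℤ → ObjectProperty T) : Prop extends
    IsGeneratingSequence 𝒢 where
  finite : IsFiniteSequence 𝒢
  nCompressed : IsNCompressedMetric (onCompacts (metricR 𝒢))
  equivalent : MetricEquivalent (onCompacts (metricR 𝒢)) (onCompacts (metricM 𝒢))

/-- The closure of compacts `⋂_n T^c ⋆ R n`. -/
def closureOfCompacts (R : ℤ → ObjectProperty T) : ObjectProperty T := fun F =>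
  ∀ n, ObjectProperty.extensionProduct (compacts T) (R n) F

/-- `𝒢^⊥ = ⋃_n (ℳ^𝒢_n)^⊥`. -/
def seqPerp (𝒢 : ℤ → ObjectProperty T) : ObjectProperty T := fun F =>
  ∃ n, (metricM 𝒢 n).rightOrthogonal F

/-- `T^b_c`: the bounded objects in the closure of compacts. -/
def boundedClosure (𝒢 R : ℤ → ObjectProperty T) : ObjectProperty T :=
  closureOfCompacts R ⊓ seqPerp 𝒢

end Generating

section SingleGenerator

variable {T : Type u} [Category.{v} T] [HasZeroObject T] [HasShift T ℤ] [Preadditive T]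
  [∀ n : ℤ, (shiftFunctor T n).Additive] [Pretriangulated T]

/-- The sequence `𝒢^n = {Σ^{-n} G}`. -/
def seqI (G : T) (n : ℤ) : ObjectProperty T := .singleton (G⟦-n⟧)

/-- The sequence `𝒢^n = {Σ^n G}`. -/
def seqII (G : T) (n : ℤ) : ObjectProperty T := .singleton (G⟦n⟧)

/-- `Hom(G, Σ^n G) = 0` for `n ≫ 0`. -/
def HypothesisI (G : T) : Prop := ∃ N : ℤ, ∀ n ≥ N, ∀ f : G ⟶ G⟦n⟧, f = 0

/-- `Hom(G, Σ^n G) = 0` for `n ≪ 0`. -/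
def HypothesisII (G : T) : Prop := ∃ N : ℤ, ∀ n ≤ N, ∀ f : G ⟶ G⟦n⟧, f = 0

/-- The aisle `T_G^{≤ 0} = Coprod({Σ^i G : i ≥ 0})` of the t-structure generated by `G`. -/
def tAisle (G : T) : ObjectProperty T :=
  coprodClosure fun X => ∃ i : ℤ, 0 ≤ i ∧ X = G⟦i⟧

/-- `V_G = ({Σ^i G : i ≤ 0})⊥`, for the co-t-structure generated by `G`. -/
def coTV (G : T) : ObjectProperty T :=
  ObjectProperty.rightOrthogonal fun X => ∃ i : ℤ, i ≤ 0 ∧ X = G⟦i⟧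

/-- `U_G = ⊥(Σ V_G)`, for the co-t-structure generated by `G`. -/
def coTU (G : T) : ObjectProperty T := ((coTV G).shift (-1 : ℤ)).leftOrthogonal

/-- `T^-_c = ⋂_n T^c ⋆ T_G^{≤ -n}`, where `T_G^{≤ -n} = Σ^n T_G^{≤ 0}`. -/
def minusCompacts (G : T) : ObjectProperty T :=
  closureOfCompacts fun n => (tAisle G).shift (-n)

/-- `T^+_c = ⋂_n T^c ⋆ T_G^{≥ n}`, where `T_G^{≥ n} = Σ^{-n} U_G`. -/
def plusCompacts (G : T) : ObjectProperty T :=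
  closureOfCompacts fun n => (coTU G).shift n

/-- `ᴵT^b_c = {F ∈ T^-_c : Hom(Σ^i G, F) = 0 for i ≫ 0}`. -/
def boundedI (G : T) : ObjectProperty T := fun F =>
  minusCompacts G F ∧ ∃ N : ℤ, ∀ i ≥ N, ∀ f : G⟦i⟧ ⟶ F, f = 0

/-- `ᴵᴵT^b_c = {F ∈ T^+_c : Hom(Σ^i G, F) = 0 for i ≪ 0}`. -/
def boundedII (G : T) : ObjectProperty T := fun F =>
  plusCompacts G F ∧ ∃ N : ℤ, ∀ i ≤ N, ∀ f : G⟦i⟧ ⟶ F, f = 0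

end SingleGenerator

end TriMetric

/-!
Let `Tᶜ` be the compact objects of a triangulated category `T`, and let `A ⊆ Tᶜ` be admissible,
with complement `B`, so that each compact `c` sits in a triangle `a ⟶ c ⟶ b` with `a ∈ A`,
`b ∈ B` and `Hom(A, B) = 0`. The claim is that each bounded object `F` in the closure of compacts
sits in a triangle `X ⟶ F ⟶ Y` with `X ∈ Coprod(A)`, `Y ∈ Coprod(B)` and `X` again bounded in the
closure of compacts. Since `Hom(Coprod(A), Coprod(B)) = 0`, such triangles give the right adjoint
of the inclusion (`isRightAdmissibleIn_of_triangles`) and the semiorthogonal decompositions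
(`isSemiorthogonalDecompositionIn_bounded`).

The coreflection and the reflection of `Tᶜ` onto `A` are triangulated endofunctors of `Tᶜ`
(`IsRightAdmissible.exists_endofunctor`, `IsLeftAdmissible.exists_endofunctor`), so compressedness
of the metrics makes them continuous (`IsAdmissibleIn.isContinuousDecomposition`).

*Existence of the triangle.* `F` is an extension of an arbitrarily small error `D ∈ R n` by a
compact object, where `D` is itself in the closure of compacts. The compact object decomposes. For
`D`, approximating again and again gives a tower `D ⟶ D₁ ⟶ D₂ ⟶ ⋯` with compact fibres in `R n`
and with `Dₖ` ever smaller. Compact objects do not see small objects, so the homotopy colimit of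
the tower vanishes, and `D` is an extension of a coproduct of iterated extensions of the fibres by
the suspension of one (`extensionProduct_of_tower`, `closureOfCompacts_inf_le`). Continuity of the
coreflection, applied to the fibres, decomposes `D` with a small component in `Coprod(A)`
(`closureOfCompacts_inf_le_extensionProduct`). Combining the pieces decomposes `F` with a component
in `Coprod(A)` that is compact up to a small error; by uniqueness of the component this holds for
all error sizes at once (`exists_triangle_closureOfCompacts`).

*Boundedness of the component.* Maps from a compact `c` to `X ∈ Coprod(A)` factor through the
reflection of `c` to `A`, which is in `ℳ m` when `c` is in a deeper layer of `ℳ`, and maps from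
objects of `A` to `X` are detected in `F` (`rightOrthogonal_of_triangle`).

For a single generator `G`, the hypotheses have to be verified. The main point is that maps from a
compact object to an object of `⊥(S⊥)`, where `S` is a set of compact objects, factor through
finite extensions of objects of `S` (`exists_factor_of_leftOrthogonal`): the small object argument
for `S` is a tower as above. Hence the compact objects of `⊥((ℳ n)⊥)` are those of `ℳ n`, and the
vanishing of `Hom(G, Σⁿ G)` spreads to the layers of the metric. A triangulated endofunctor `F` of
`Tᶜ` has loss bounded by the width of `F(G)` in terms of the shifts of `G`
(`isNCompressedMetric_shiftSeq`). Finally the closures of compacts formed with the t-structure and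
the co-t-structure generated by `G` agree with those of the metric (`boundedI_eq`,
`boundedII_eq`).
-/

namespace TriMetric

/-! ### Classes closed under coproducts and extensions -/

section CoproductClosed

variable {C : Type u} [Category.{v} C] [HasZeroObject C] [HasShift C ℤ] [Preadditive C]
  [∀ n : ℤ, (shiftFunctor C n).Additive] [Pretriangulated C]

/-- A property of objects that is closed under small coproducts and under extensions. -/
structure IsCoprodClosed (P : ObjectProperty C) : Prop where
  coproduct {J : Type v} (Y : J → C) (c : Cofan Y) (hc : IsColimit c) (h : ∀ j, P (Y j)) : P c.pt
  extension (D : Triangle C) (hD : D ∈ distTriang C) (h₁ : P D.obj₁) (h₃ : P D.obj₃) : P D.obj₂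

lemma coprodClosure_isCoprodClosed (P : ObjectProperty C) : IsCoprodClosed (coprodClosure P) :=
  ⟨fun Y c hc h => .coproduct Y c hc h, fun D hD h₁ h₃ => .extension D hD h₁ h₃⟩

lemma coprodClosure_le {P Q : ObjectProperty C} (hQ : IsCoprodClosed Q) (h : P ≤ Q) :
    coprodClosure P ≤ Q := by
  intro X hX
  induction hX with
  | of X hX => exact h X hX
  | coproduct Y c hc _ ih => exact hQ.coproduct Y c hc ih
  | extension D hD _ _ ih₁ ih₃ => exact hQ.extension D hD ih₁ ih₃

lemma le_coprodClosure (P : ObjectProperty C) : P ≤ coprodClosure P := fun X h => .of X h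

namespace IsCoprodClosed

variable {P Q : ObjectProperty C}

lemma of_iso (hP : IsCoprodClosed P) {X Y : C} (e : X ≅ Y) (hX : P X) : P Y :=
  hP.coproduct (fun _ : PUnit => X) _ (Cofan.isColimitMkOfUnique e PUnit) fun _ => hX

lemma isClosedUnderIsomorphisms (hP : IsCoprodClosed P) : P.IsClosedUnderIsomorphisms :=
  ⟨fun e hX => hP.of_iso e hX⟩

lemma of_isZero (hP : IsCoprodClosed P) {X : C} (hX : IsZero X) : P X :=
  hP.coproduct (J := PEmpty) (fun j => j.elim) (Cofan.mk X fun j => j.elim)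
    (Cofan.IsColimit.mk _ (fun _ => 0) (fun _ j => j.elim) fun _ _ _ => hX.eq_of_src _ _)
    fun j => j.elim

lemma containsZero (hP : IsCoprodClosed P) : P.ContainsZero :=
  ⟨0, isZero_zero C, hP.of_isZero (isZero_zero C)⟩

lemma isTriangulatedClosed₂ (hP : IsCoprodClosed P) : P.IsTriangulatedClosed₂ :=
  haveI := hP.isClosedUnderIsomorphisms
  .mk' hP.extension

lemma coproduct_small (hP : IsCoprodClosed P) {I : Type*} [Small.{v} I] (Y : I → C) (c : Cofan Y)
    (hc : IsColimit c) (h : ∀ i, P (Y i)) : P c.pt :=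
  hP.coproduct (J := Shrink.{v} I) (fun j => Y ((equivShrink I).symm j))
    (Cofan.mk c.pt fun j => c.inj ((equivShrink I).symm j))
    (Cofan.isColimitEquivOfEquiv (equivShrink I).symm c hc) fun _ => h _

lemma inf (hP : IsCoprodClosed P) (hQ : IsCoprodClosed Q) : IsCoprodClosed (P ⊓ Q) :=
  ⟨fun Y c hc h => ⟨hP.coproduct Y c hc fun j => (h j).1, hQ.coproduct Y c hc fun j => (h j).2⟩,
    fun D hD h₁ h₃ => ⟨hP.extension D hD h₁.1 h₃.1, hQ.extension D hD h₁.2 h₃.2⟩⟩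

lemma leftOrthogonal (P : ObjectProperty C) : IsCoprodClosed P.leftOrthogonal :=
  ⟨fun Y c hc h A f hA => Cofan.IsColimit.hom_ext hc _ _ fun j => by
      rw [comp_zero]; exact h j _ hA,
    fun D hD h₁ h₃ =>
      ObjectProperty.ext_of_isTriangulatedClosed₂ _ D hD h₁ h₃⟩

lemma shift (hP : IsCoprodClosed P) (n : ℤ) : IsCoprodClosed (P.shift n) :=
  ⟨fun Y c hc h => hP.coproduct _ _ (isColimitCofanMkObjOfIsColimit (shiftFunctor C n) Y c.inj
      (hc.ofIsoColimit (Cofan.ext (Iso.refl _)))) h,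
    fun D hD h₁ h₃ => hP.extension _ (Triangle.shift_distinguished D hD n) h₁ h₃⟩

/-- Maps out of a compact object into coproducts are determined by finitely many components, so
the vanishing of such maps is a property closed under coproducts. -/
lemma rightOrthogonal (hP : P ≤ compacts C) : IsCoprodClosed P.rightOrthogonal :=
  ⟨fun Y c hc h A f hA => by
      obtain ⟨s, g, rfl⟩ := hP A hA Y c hc f
      exact Finset.sum_eq_zero fun j _ => by rw [h j (g j) hA, zero_comp],
    fun D hD h₁ h₃ => ObjectProperty.ext_of_isTriangulatedClosed₂ _ D hD h₁ h₃⟩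

end IsCoprodClosed

/-- If the generators are carried into `coprodClosure Q` by a shift, so is `coprodClosure P`. -/
lemma coprodClosure_shift {P Q : ObjectProperty C} (n : ℤ)
    (h : ∀ X, P X → coprodClosure Q (X⟦n⟧)) {X : C} (hX : coprodClosure P X) :
    coprodClosure Q (X⟦n⟧) :=
  coprodClosure_le ((coprodClosure_isCoprodClosed Q).shift n) h X hX

lemma hom_coprodClosure_eq_zero {A B : ObjectProperty C} (hA : A ≤ compacts C)
    (h : ∀ ⦃X Y : C⦄ (f : X ⟶ Y), A X → B Y → f = 0) ⦃X Y : C⦄ (f : X ⟶ Y)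
    (hX : coprodClosure A X) (hY : coprodClosure B Y) : f = 0 := by
  have h₁ : coprodClosure B ≤ A.rightOrthogonal :=
    coprodClosure_le (.rightOrthogonal hA) fun Y hY X f hX => h f hX hY
  exact coprodClosure_le (Q := ObjectProperty.leftOrthogonal (coprodClosure B)) (.leftOrthogonal _)
    (fun X hX Y f hY => h₁ Y hY f hX) X hX f hY

section Unbundled

variable {X Y Z A : C} {f : X ⟶ Y} {g : Y ⟶ Z} {h : Z ⟶ X⟦(1 : ℤ)⟧}

lemma dist_zero₁₂ (hT : Triangle.mk f g h ∈ distTriang C) : f ≫ g = 0 :=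
  comp_distTriang_mor_zero₁₂ _ hT

lemma dist_zero₂₃ (hT : Triangle.mk f g h ∈ distTriang C) : g ≫ h = 0 :=
  comp_distTriang_mor_zero₂₃ _ hT

lemma dist_zero₃₁ (hT : Triangle.mk f g h ∈ distTriang C) : h ≫ f⟦(1 : ℤ)⟧' = 0 :=
  comp_distTriang_mor_zero₃₁ _ hT

lemma dist_lift₂ (hT : Triangle.mk f g h ∈ distTriang C) (a : A ⟶ Y) (ha : a ≫ g = 0) :
    ∃ b : A ⟶ X, a = b ≫ f :=
  Triangle.coyoneda_exact₂ _ hT a ha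

lemma dist_lift₃ (hT : Triangle.mk f g h ∈ distTriang C) (a : A ⟶ Z) (ha : a ≫ h = 0) :
    ∃ b : A ⟶ Y, a = b ≫ g :=
  Triangle.coyoneda_exact₃ _ hT a ha

lemma dist_desc₂ (hT : Triangle.mk f g h ∈ distTriang C) (a : Y ⟶ A) (ha : f ≫ a = 0) :
    ∃ b : Z ⟶ A, a = g ≫ b :=
  Triangle.yoneda_exact₂ _ hT a ha

lemma dist_desc₃ (hT : Triangle.mk f g h ∈ distTriang C) (a : Z ⟶ A) (ha : g ≫ a = 0) :
    ∃ b : X⟦(1 : ℤ)⟧ ⟶ A, a = h ≫ b :=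
  Triangle.yoneda_exact₃ _ hT a ha

lemma dist_desc₁ (hT : Triangle.mk f g h ∈ distTriang C) (a : X⟦(1 : ℤ)⟧ ⟶ A)
    (ha : h ≫ a = 0) : ∃ b : Y⟦(1 : ℤ)⟧ ⟶ A, a = f⟦(1 : ℤ)⟧' ≫ b := by
  obtain ⟨b, hb⟩ : ∃ b : Y⟦(1 : ℤ)⟧ ⟶ A, a = (-(f⟦(1 : ℤ)⟧')) ≫ b :=
    Triangle.yoneda_exact₃ _ (rot_of_distTriang _ hT) a ha
  exact ⟨-b, by rw [hb, Preadditive.neg_comp, Preadditive.comp_neg]⟩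

lemma dist_hom {X' Y' Z' : C} {f' : X' ⟶ Y'} {g' : Y' ⟶ Z'} {h' : Z' ⟶ X'⟦(1 : ℤ)⟧}
    (hT : Triangle.mk f g h ∈ distTriang C) (hT' : Triangle.mk f' g' h' ∈ distTriang C)
    (a : X ⟶ X') (b : Y ⟶ Y') (hab : f ≫ b = a ≫ f') :
    ∃ c : Z ⟶ Z', g ≫ c = b ≫ g' ∧ h ≫ a⟦(1 : ℤ)⟧' = c ≫ h' :=
  complete_distinguished_triangle_morphism _ _ hT hT' a b hab

end Unbundled

/-- A coproduct of distinguished triangles is distinguished: cones of coproducts of maps are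
coproducts of cones. -/
lemma exists_coproduct_triangle {J : Type*} {X Y Z : J → C} {f : ∀ j, X j ⟶ Y j}
    {g : ∀ j, Y j ⟶ Z j} {h : ∀ j, Z j ⟶ (X j)⟦(1 : ℤ)⟧}
    (hT : ∀ j, Triangle.mk (f j) (g j) (h j) ∈ distTriang C)
    (c₁ : Cofan X) (hc₁ : IsColimit c₁) (c₂ : Cofan Y) (hc₂ : IsColimit c₂) :
    ∃ (c₃ : Cofan Z) (_ : IsColimit c₃)
      (f' : c₁.pt ⟶ c₂.pt) (g' : c₂.pt ⟶ c₃.pt) (h' : c₃.pt ⟶ c₁.pt⟦(1 : ℤ)⟧),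
      Triangle.mk f' g' h' ∈ distTriang C ∧
      (∀ j, c₁.inj j ≫ f' = f j ≫ c₂.inj j) ∧ (∀ j, c₂.inj j ≫ g' = g j ≫ c₃.inj j) := by
  let f' : c₁.pt ⟶ c₂.pt := Cofan.IsColimit.desc hc₁ fun j => f j ≫ c₂.inj j
  have hf : ∀ j, c₁.inj j ≫ f' = f j ≫ c₂.inj j := Cofan.IsColimit.fac hc₁ _
  obtain ⟨W, g', h', hT'⟩ := distinguished_cocone_triangle f'
  choose w hw₁ hw₂ using fun j => dist_hom (hT j) hT' (c₁.inj j) (c₂.inj j) (hf j).symm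
  have hs : ∀ {U : J → C} (c : Cofan U) (_ : IsColimit c),
      IsColimit (Cofan.mk (c.pt⟦(1 : ℤ)⟧) fun j => (c.inj j)⟦(1 : ℤ)⟧') := fun c hc =>
    isColimitCofanMkObjOfIsColimit (shiftFunctor C (1 : ℤ)) _ c.inj
      (hc.ofIsoColimit (Cofan.ext (Iso.refl _)))
  have hex : ∀ (s : Cofan Z), ∃ γ : W ⟶ s.pt, ∀ j, w j ≫ γ = s.inj j := by
    intro s
    obtain ⟨β, hβ⟩ : ∃ β : c₂.pt ⟶ s.pt, ∀ j, c₂.inj j ≫ β = g j ≫ s.inj j :=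
      ⟨_, Cofan.IsColimit.fac hc₂ _⟩
    obtain ⟨γ, hγ⟩ := dist_desc₂ hT' β (Cofan.IsColimit.hom_ext hc₁ _ _ fun j => by
      rw [reassoc_of% hf, hβ, ← Category.assoc, dist_zero₁₂ (hT j), zero_comp, comp_zero])
    choose δ hδ using fun j => dist_desc₃ (hT j) (s.inj j - w j ≫ γ) (by
        rw [Preadditive.comp_sub, reassoc_of% hw₁, ← hγ, hβ, sub_self])
    obtain ⟨δ', hδ'⟩ : ∃ δ' : c₁.pt⟦(1 : ℤ)⟧ ⟶ s.pt, ∀ j, (c₁.inj j)⟦(1 : ℤ)⟧' ≫ δ' = δ j :=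
      ⟨_, Cofan.IsColimit.fac (hs c₁ hc₁) δ⟩
    refine ⟨γ + h' ≫ δ', fun j => ?_⟩
    rw [Preadditive.comp_add, ← reassoc_of% hw₂, hδ', ← hδ]
    abel
  have huniq : ∀ {A : C} (ε : W ⟶ A), (∀ j, w j ≫ ε = 0) → ε = 0 := by
    intro A ε hε
    obtain ⟨θ, rfl⟩ := dist_desc₃ hT' ε (Cofan.IsColimit.hom_ext hc₂ _ _ fun j => by
      rw [← reassoc_of% hw₁, hε, comp_zero, comp_zero])
    choose η hη using fun j => dist_desc₁ (hT j) ((c₁.inj j)⟦(1 : ℤ)⟧' ≫ θ) (by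
      rw [reassoc_of% hw₂, hε])
    obtain ⟨η', hη'⟩ : ∃ η' : c₂.pt⟦(1 : ℤ)⟧ ⟶ A, ∀ j, (c₂.inj j)⟦(1 : ℤ)⟧' ≫ η' = η j :=
      ⟨_, Cofan.IsColimit.fac (hs c₂ hc₂) η⟩
    have : θ = (f'⟦(1 : ℤ)⟧') ≫ η' := by
      refine Cofan.IsColimit.hom_ext (hs c₁ hc₁) _ _ fun j => ?_
      change (c₁.inj j)⟦(1 : ℤ)⟧' ≫ θ = (c₁.inj j)⟦(1 : ℤ)⟧' ≫ (f'⟦(1 : ℤ)⟧') ≫ η'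
      rw [hη, ← Functor.map_comp_assoc, hf, Functor.map_comp_assoc, hη']
    rw [this, ← Category.assoc, dist_zero₃₁ hT', zero_comp]
  choose desc hdesc using hex
  refine ⟨Cofan.mk W w, Cofan.IsColimit.mk _ desc (fun s j => hdesc s j)
    fun s m hm => ?_, f', g', h', hT', hf, fun j => (hw₁ j).symm⟩
  rw [← sub_eq_zero]
  refine huniq _ fun j => ?_
  rw [Preadditive.comp_sub, hdesc, sub_eq_zero]
  exact hm j

section ExtensionProduct

open ObjectProperty

lemma extensionProduct_le {P₁ P₂ Q : ObjectProperty C} (hQ : IsCoprodClosed Q) (h₁ : P₁ ≤ Q)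
    (h₂ : P₂ ≤ Q) : extensionProduct P₁ P₂ ≤ Q := by
  rintro X ⟨Y, Z, f, g, h, hT, hY, hZ⟩
  exact hQ.extension _ hT (h₁ _ hY) (h₂ _ hZ)

/-- Two consecutive extension steps can be exchanged when the connecting maps vanish: such
extensions split. -/
lemma extensionProduct_comm {U V : ObjectProperty C}
    (h : ∀ ⦃X Y : C⦄ (f : X ⟶ Y⟦(1 : ℤ)⟧), U X → V Y → f = 0) :
    extensionProduct V U ≤ extensionProduct U V := by
  rintro X ⟨Y, Z, f, g, w, hT, hY, hZ⟩
  obtain ⟨e, -, -⟩ := exists_iso_binaryBiproduct_of_distTriang _ hT (h w hZ hY)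
  have : extensionProduct U V (Z ⊞ Y) :=
    ⟨_, _, _, _, _, binaryBiproductTriangle_distinguished Z Y, hZ, hY⟩
  exact prop_of_iso _ (e ≪≫ biprod.braiding _ _).symm this

variable [IsTriangulated C]

/-- An extension of extensions can be rearranged so that the `U`-parts come first. -/
lemma extensionProduct_extensionProduct_le {U U' V V' : ObjectProperty C}
    (h : ∀ ⦃X Y : C⦄ (f : X ⟶ Y⟦(1 : ℤ)⟧), U' X → V Y → f = 0) :
    extensionProduct (extensionProduct U V) (extensionProduct U' V') ≤
      extensionProduct (extensionProduct U U') (extensionProduct V V') := by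
  rw [extensionProduct_assoc, extensionProduct_assoc, ← extensionProduct_assoc V,
    ← extensionProduct_assoc U' V]
  exact monotone_extensionProduct_right _
    (monotone_extensionProduct_left _ (extensionProduct_comm h))

lemma IsCoprodClosed.extensionProduct [HasCoproducts.{v} C] {U V : ObjectProperty C}
    (hU : IsCoprodClosed U) (hV : IsCoprodClosed V)
    (h : ∀ ⦃X Y : C⦄ (f : X ⟶ Y⟦(1 : ℤ)⟧), U X → V Y → f = 0) :
    IsCoprodClosed (extensionProduct U V) where
  coproduct {J} Y c hc hY := by
    choose X Z f g w hT hX hZ using hY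
    obtain ⟨c₃, hc₃, f', g', w', hT', -, -⟩ :=
      exists_coproduct_triangle hT _ (coproductIsCoproduct X) c hc
    exact ⟨_, _, f', g', w', hT', hU.coproduct _ _ (coproductIsCoproduct X) hX,
      hV.coproduct _ c₃ hc₃ hZ⟩
  extension D hD h₁ h₃ := by
    have : ObjectProperty.extensionProduct (ObjectProperty.extensionProduct U V)
        (ObjectProperty.extensionProduct U V) D.obj₂ := ⟨_, _, _, _, _, hD, h₁, h₃⟩
    have := extensionProduct_extensionProduct_le h _ this
    exact monotone_extensionProduct_right _ (extensionProduct_le hV le_rfl le_rfl) _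
      (monotone_extensionProduct_left _ (extensionProduct_le hU le_rfl le_rfl) _ this)

end ExtensionProduct

end CoproductClosed

/-! ### Homotopy colimits of sequences -/

section Telescope

variable {C : Type u} [Category.{v} C] [Preadditive C]

lemma compacts_small {X : C} (hX : compacts C X) {I : Type*} [Small.{v} I] {Y : I → C}
    (c : Cofan Y) (hc : IsColimit c) (f : X ⟶ c.pt) :
    ∃ (s : Finset I) (g : ∀ i, X ⟶ Y i), f = ∑ i ∈ s, g i ≫ c.inj i := by
  classical
  obtain ⟨s, g, hg⟩ := hX (J := Shrink.{v} I) (fun j => Y ((equivShrink I).symm j))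
    (Cofan.mk c.pt fun j => c.inj ((equivShrink I).symm j))
    (Cofan.isColimitEquivOfEquiv (equivShrink I).symm c hc) f
  have : ∀ i, ∃ g' : X ⟶ Y i, ∀ j (h : (equivShrink I).symm j = i),
      g j ≫ c.inj ((equivShrink I).symm j) = g' ≫ c.inj i := by
    intro i
    obtain ⟨j, rfl⟩ := (equivShrink I).symm.surjective i
    refine ⟨g j, fun j' h => ?_⟩
    obtain rfl := (equivShrink I).symm.injective h
    rfl
  choose g' hg' using this
  refine ⟨s.map (equivShrink I).symm.toEmbedding, g', hg.trans ?_⟩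
  rw [Finset.sum_map]
  exact Finset.sum_congr rfl fun j _ => hg' _ j rfl

/-- The projection of a coproduct onto one of its summands. -/
noncomputable def cofanProj {I : Type*} [DecidableEq I] {Y : I → C} {c : Cofan Y}
    (hc : IsColimit c) (j : I) : c.pt ⟶ Y j :=
  Cofan.IsColimit.desc hc fun i => if h : i = j then eqToHom (by rw [h]) else 0

section

variable {I : Type*} [DecidableEq I] {Y : I → C} {c : Cofan Y} (hc : IsColimit c)

lemma inj_cofanProj_self (j : I) : c.inj j ≫ cofanProj hc j = 𝟙 _ := by
  rw [cofanProj, Cofan.IsColimit.fac, dif_pos rfl, eqToHom_refl]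

lemma inj_cofanProj_of_ne {i j : I} (h : i ≠ j) : c.inj i ≫ cofanProj hc j = 0 := by
  rw [cofanProj, Cofan.IsColimit.fac, dif_neg h]

lemma exists_finset_cofanProj [Small.{v} I] {X : C} (hX : compacts C X) (f : X ⟶ c.pt) :
    ∃ s : Finset I, f = ∑ i ∈ s, (f ≫ cofanProj hc i) ≫ c.inj i ∧
      ∀ i ∉ s, f ≫ cofanProj hc i = 0 := by
  obtain ⟨s, g, hg⟩ := compacts_small hX c hc f
  have h₁ : ∀ i, f ≫ cofanProj hc i = if i ∈ s then g i else 0 := by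
    intro i
    rw [hg, Preadditive.sum_comp]
    split_ifs with hi
    · rw [Finset.sum_eq_single_of_mem i hi fun j _ hj => ?_]
      · rw [Category.assoc, inj_cofanProj_self, Category.comp_id]
      · rw [Category.assoc, inj_cofanProj_of_ne hc hj, comp_zero]
    · refine Finset.sum_eq_zero fun j hj => ?_
      rw [Category.assoc, inj_cofanProj_of_ne hc (by rintro rfl; exact hi hj), comp_zero]
  refine ⟨s, hg.trans (Finset.sum_congr rfl fun i hi => ?_), fun i hi => ?_⟩
  · rw [h₁, if_pos hi]
  · rw [h₁, if_neg hi]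

end

variable {D : ℕ → C} (φ : ∀ k, D k ⟶ D (k + 1))

/-- The composite transition maps out of the first stage of a sequence. -/
def fromZero : ∀ m, D 0 ⟶ D m
  | 0 => 𝟙 _
  | m + 1 => fromZero m ≫ φ m

/-- The endomorphism `1 - shift` of `∐ D k`, whose cone is the homotopy colimit of the sequence. -/
noncomputable def oneSubShift {c : Cofan D} (hc : IsColimit c) : c.pt ⟶ c.pt :=
  Cofan.IsColimit.desc hc fun k => c.inj k - φ k ≫ c.inj (k + 1)

section

variable {c : Cofan D} (hc : IsColimit c)

lemma inj_oneSubShift (k : ℕ) :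
    c.inj k ≫ oneSubShift φ hc = c.inj k - φ k ≫ c.inj (k + 1) :=
  Cofan.IsColimit.fac hc _ k

lemma inj_oneSubShift_assoc (k : ℕ) {A : C} (a : c.pt ⟶ A) :
    c.inj k ≫ oneSubShift φ hc ≫ a = (c.inj k - φ k ≫ c.inj (k + 1)) ≫ a := by
  rw [← Category.assoc, inj_oneSubShift]

lemma oneSubShift_proj_zero : oneSubShift φ hc ≫ cofanProj hc 0 = cofanProj hc 0 := by
  refine Cofan.IsColimit.hom_ext hc _ _ fun k => ?_
  rw [inj_oneSubShift_assoc, Preadditive.sub_comp, Category.assoc,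
    inj_cofanProj_of_ne hc (Nat.succ_ne_zero k), comp_zero, sub_zero]

lemma oneSubShift_proj_succ (m : ℕ) : oneSubShift φ hc ≫ cofanProj hc (m + 1) =
    cofanProj hc (m + 1) - cofanProj hc m ≫ φ m := by
  refine Cofan.IsColimit.hom_ext hc _ _ fun k => ?_
  rw [inj_oneSubShift_assoc, Preadditive.sub_comp, Category.assoc, Preadditive.comp_sub]
  congr 1
  by_cases h : k = m
  · subst h
    rw [inj_cofanProj_self, reassoc_of% (inj_cofanProj_self hc k), Category.comp_id]
  · rw [inj_cofanProj_of_ne hc (by simpa using h), reassoc_of% (inj_cofanProj_of_ne hc h),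
      comp_zero, zero_comp]

lemma eq_zero_of_comp_oneSubShift {X : C} (hX : compacts C X) (f : X ⟶ c.pt)
    (hf : f ≫ oneSubShift φ hc = 0) : f = 0 := by
  have h : ∀ k, f ≫ cofanProj hc k = 0 := by
    intro k
    induction k with
    | zero => rw [← oneSubShift_proj_zero φ hc, reassoc_of% hf, zero_comp]
    | succ k ih =>
      have := oneSubShift_proj_succ φ hc k
      rw [← sub_add_cancel (cofanProj hc (k + 1)) (cofanProj hc k ≫ φ k), ← this,
        Preadditive.comp_add, reassoc_of% hf, reassoc_of% ih, zero_comp, zero_comp, add_zero]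
  obtain ⟨s, hs, -⟩ := exists_finset_cofanProj hc hX f
  rw [hs]
  exact Finset.sum_eq_zero fun k _ => by rw [h, zero_comp]

/-- If `f` dies in the homotopy colimit, witnessed by `g`, then the components of `g` are the images
of `f` in the stages, and all but finitely many of them vanish. -/
lemma exists_comp_fromZero_eq_zero {X : C} (hX : compacts C X) (f : X ⟶ D 0) (g : X ⟶ c.pt)
    (h : g ≫ oneSubShift φ hc = f ≫ c.inj 0) : ∃ m, f ≫ fromZero φ m = 0 := by
  have key : ∀ k, g ≫ cofanProj hc k = f ≫ fromZero φ k := by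
    intro k
    induction k with
    | zero => rw [← oneSubShift_proj_zero φ hc, reassoc_of% h, inj_cofanProj_self]; rfl
    | succ k ih =>
      have := oneSubShift_proj_succ φ hc k
      rw [← sub_add_cancel (cofanProj hc (k + 1)) (cofanProj hc k ≫ φ k), ← this,
        Preadditive.comp_add, reassoc_of% h, reassoc_of% ih,
        inj_cofanProj_of_ne hc (Nat.succ_ne_zero k).symm, comp_zero, zero_add]
      rfl
  obtain ⟨s, -, hs⟩ := exists_finset_cofanProj hc hX g
  obtain ⟨m, hm⟩ := Infinite.exists_notMem_finset s
  exact ⟨m, by rw [← key, hs m hm]⟩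

variable [HasShift C ℤ] [∀ n : ℤ, (shiftFunctor C n).Additive]

lemma eq_zero_of_comp_oneSubShift_shift {X : C} (hX : compacts C X) (f : X ⟶ c.pt⟦(1 : ℤ)⟧)
    (hf : f ≫ (oneSubShift φ hc)⟦(1 : ℤ)⟧' = 0) : f = 0 := by
  let c' : Cofan fun k => (D k)⟦(1 : ℤ)⟧ := Cofan.mk (c.pt⟦(1 : ℤ)⟧) fun j => (c.inj j)⟦(1 : ℤ)⟧'
  have hc' : IsColimit c' := isColimitCofanMkObjOfIsColimit (shiftFunctor C (1 : ℤ)) _ c.inj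
    (hc.ofIsoColimit (Cofan.ext (Iso.refl _)))
  refine eq_zero_of_comp_oneSubShift (fun k => (φ k)⟦(1 : ℤ)⟧') hc' hX f ?_
  have : oneSubShift (fun k => (φ k)⟦(1 : ℤ)⟧') hc' = (oneSubShift φ hc)⟦(1 : ℤ)⟧' := by
    refine Cofan.IsColimit.hom_ext hc' _ _ fun k => ?_
    rw [inj_oneSubShift]
    change (c.inj k)⟦(1 : ℤ)⟧' - (φ k)⟦(1 : ℤ)⟧' ≫ (c.inj (k + 1))⟦(1 : ℤ)⟧' =
      (c.inj k)⟦(1 : ℤ)⟧' ≫ (oneSubShift φ hc)⟦(1 : ℤ)⟧'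
    rw [← Functor.map_comp, ← Functor.map_comp, inj_oneSubShift, Functor.map_sub]
  rw [this]
  exact hf

variable [HasZeroObject C] [Pretriangulated C]

/-- A map from a compact object to a homotopy colimit factors through all late enough stages. -/
lemma exists_factor_hocolim {H : C} {p : c.pt ⟶ H} {δ : H ⟶ c.pt⟦(1 : ℤ)⟧}
    (hT : Triangle.mk (oneSubShift φ hc) p δ ∈ distTriang C) {X : C} (hX : compacts C X)
    (f : X ⟶ H) (N : ℕ) : ∃ k ≥ N, ∃ g : X ⟶ D k, f = g ≫ c.inj k ≫ p := by
  have hι : ∀ k, c.inj k ≫ p = φ k ≫ c.inj (k + 1) ≫ p := by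
    intro k
    have := c.inj k ≫= dist_zero₁₂ hT
    rwa [inj_oneSubShift_assoc, Preadditive.sub_comp, comp_zero, sub_eq_zero,
      Category.assoc] at this
  have push : ∀ k m, k ≤ m → ∃ ψ : D k ⟶ D m, c.inj k ≫ p = ψ ≫ c.inj m ≫ p := by
    intro k m hkm
    induction m, hkm using Nat.le_induction with
    | base => exact ⟨𝟙 _, by rw [Category.id_comp]⟩
    | succ m _ ih =>
      obtain ⟨ψ, hψ⟩ := ih
      exact ⟨ψ ≫ φ m, by rw [hψ, hι m, Category.assoc]⟩
  obtain ⟨g, rfl⟩ := dist_lift₃ hT f (eq_zero_of_comp_oneSubShift_shift φ hc hX _ (by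
    rw [Category.assoc, dist_zero₃₁ hT, comp_zero]))
  obtain ⟨s, a, rfl⟩ := compacts_small hX c hc g
  induction s using Finset.induction_on with
  | empty => exact ⟨N, le_rfl, 0, by simp⟩
  | insert j s hj ih =>
    obtain ⟨k, hk, b, hb⟩ := ih
    obtain ⟨ψ₁, h₁⟩ := push j (max j k) (le_max_left _ _)
    obtain ⟨ψ₂, h₂⟩ := push k (max j k) (le_max_right _ _)
    refine ⟨max j k, hk.trans (le_max_right _ _), a j ≫ ψ₁ + b ≫ ψ₂, ?_⟩
    rw [Finset.sum_insert hj, Preadditive.add_comp, hb, Category.assoc, h₁, h₂,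
      Preadditive.add_comp, Category.assoc, Category.assoc]

lemma exists_fromZero_eq_zero_of_hocolim {H : C} {p : c.pt ⟶ H} {δ : H ⟶ c.pt⟦(1 : ℤ)⟧}
    (hT : Triangle.mk (oneSubShift φ hc) p δ ∈ distTriang C) {X : C} (hX : compacts C X)
    (f : X ⟶ D 0) (hf : f ≫ c.inj 0 ≫ p = 0) : ∃ m, f ≫ fromZero φ m = 0 := by
  obtain ⟨g, hg⟩ := dist_lift₂ hT (f ≫ c.inj 0) (by rw [Category.assoc, hf])
  exact exists_comp_fromZero_eq_zero φ hc hX f g hg.symm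

end

variable [HasZeroObject C] [HasShift C ℤ] [∀ n : ℤ, (shiftFunctor C n).Additive]
  [Pretriangulated C]

/-- The homotopy colimit of a constant sequence is its value. -/
lemma nonempty_iso_hocolim_const {X : C} {c : Cofan fun _ : ℕ => X} (hc : IsColimit c) {H : C}
    {p : c.pt ⟶ H} {δ : H ⟶ c.pt⟦(1 : ℤ)⟧}
    (hT : Triangle.mk (oneSubShift (fun _ => 𝟙 X) hc) p δ ∈ distTriang C) : Nonempty (X ≅ H) := by
  -- `1 - shift` has the retraction whose `k`-th component is `- ∑ j < k, inj j`
  have hδ : δ = 0 := by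
    obtain ⟨ρ, hρ⟩ : ∃ ρ : c.pt ⟶ c.pt, ∀ k, c.inj k ≫ ρ = -∑ j ∈ Finset.range k, c.inj j :=
      ⟨_, Cofan.IsColimit.fac hc fun k => -∑ j ∈ Finset.range k, c.inj j⟩
    have h1 : oneSubShift (fun _ => 𝟙 X) hc ≫ ρ = 𝟙 _ :=
      Cofan.IsColimit.hom_ext hc _ _ fun k => by
        rw [inj_oneSubShift_assoc, Preadditive.sub_comp, Category.id_comp, hρ, hρ,
          Finset.sum_range_succ, Category.comp_id]
        abel
    have := dist_zero₃₁ hT =≫ ρ⟦(1 : ℤ)⟧'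
    rwa [Category.assoc, ← Functor.map_comp, h1, CategoryTheory.Functor.map_id, Category.comp_id,
      zero_comp] at this
  have hp : ∀ k, c.inj k ≫ p = c.inj 0 ≫ p := by
    intro k
    induction k with
    | zero => rfl
    | succ k ih =>
      have := c.inj k ≫= dist_zero₁₂ hT
      rw [inj_oneSubShift_assoc, Preadditive.sub_comp, comp_zero, sub_eq_zero,
        Category.id_comp] at this
      rw [← this, ih]
  obtain ⟨q₀, hq₀⟩ : ∃ q₀ : c.pt ⟶ X, ∀ k, c.inj k ≫ q₀ = 𝟙 X :=
    ⟨_, Cofan.IsColimit.fac hc fun _ => 𝟙 X⟩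
  obtain ⟨q, hq⟩ := dist_desc₂ hT q₀ (Cofan.IsColimit.hom_ext hc _ _ fun k => by
    rw [inj_oneSubShift_assoc, Preadditive.sub_comp, Category.id_comp, hq₀, hq₀, sub_self,
      comp_zero])
  refine ⟨⟨c.inj 0 ≫ p, q, by rw [Category.assoc, ← hq, hq₀], ?_⟩⟩
  obtain ⟨θ, hθ⟩ := dist_desc₃ hT (q ≫ c.inj 0 ≫ p - 𝟙 H)
    (Cofan.IsColimit.hom_ext hc _ _ fun k => by
      rw [Preadditive.comp_sub, Preadditive.comp_sub, ← reassoc_of% hq, reassoc_of% hq₀,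
        Category.comp_id, hp k, sub_self, comp_zero])
  rw [← sub_eq_zero, hθ, hδ, zero_comp]

end Telescope

/-! ### Towers with vanishing homotopy colimit -/

section Tower

variable {C : Type u} [Category.{v} C] [HasZeroObject C] [HasShift C ℤ] [Preadditive C]
  [∀ n : ℤ, (shiftFunctor C n).Additive] [Pretriangulated C]

lemma compacts_shift {X : C} (hX : compacts C X) (n : ℤ) : compacts C (X⟦n⟧) :=
  (compacts C).le_shift n X hX

/-- The fibre `X` of a map `Y ⟶ Z` is an extension of `Y` by `Z⟦-1⟧`. -/
lemma exists_fibre_triangle {X Y Z : C} {f : X ⟶ Y} {g : Y ⟶ Z} {h : Z ⟶ X⟦(1 : ℤ)⟧}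
    (hT : Triangle.mk f g h ∈ distTriang C) :
    ∃ (a : Z⟦(-1 : ℤ)⟧ ⟶ X) (c : Y ⟶ Z⟦(-1 : ℤ)⟧⟦(1 : ℤ)⟧), Triangle.mk a f c ∈ distTriang C :=
  ⟨_, _, inv_rot_of_distTriang _ hT⟩

lemma exists_rotated_triangle {X Y Z : C} {f : X ⟶ Y} {g : Y ⟶ Z} {h : Z ⟶ X⟦(1 : ℤ)⟧}
    (hT : Triangle.mk f g h ∈ distTriang C) :
    ∃ c : X⟦(1 : ℤ)⟧ ⟶ Y⟦(1 : ℤ)⟧, Triangle.mk g h c ∈ distTriang C :=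
  ⟨_, rot_of_distTriang _ hT⟩

/-- The fibres of the composites out of the first stage of a tower are iterated extensions of the
fibres of the transition maps. -/
lemma exists_fibre_fromZero [IsTriangulated C] {P : ObjectProperty C} (hP : IsCoprodClosed P)
    {D : ℕ → C} (φ : ∀ k, D k ⟶ D (k + 1))
    (hφ : ∀ k, ∃ (K : C) (a : K ⟶ D k) (b : D (k + 1) ⟶ K⟦(1 : ℤ)⟧),
      Triangle.mk a (φ k) b ∈ distTriang C ∧ P K) (m : ℕ) :
    ∃ (K : C) (a : K ⟶ D 0) (b : D m ⟶ K⟦(1 : ℤ)⟧),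
      Triangle.mk a (fromZero φ m) b ∈ distTriang C ∧ P K := by
  induction m with
  | zero => exact ⟨0, 0, 0, contractible_distinguished₁ (D 0), hP.of_isZero (isZero_zero C)⟩
  | succ m ih =>
    obtain ⟨K, a, b, hT, hK⟩ := ih
    obtain ⟨K', a', b', hT', hK'⟩ := hφ m
    obtain ⟨L, a'', b'', hT''⟩ := distinguished_cocone_triangle₁ (fromZero φ (m + 1))
    exact ⟨L, a'', b'', hT'',
      hP.extension _ (Triangulated.someOctahedron' rfl hT hT' hT'').mem hK hK'⟩

/-- A tower whose homotopy colimit vanishes exhibits its first stage as an extension of a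
coproduct of fibres by the suspension of one. -/
lemma extensionProduct_of_tower [IsTriangulated C] (hC : IsCompactlyGenerated C)
    {P : ObjectProperty C} (hP : IsCoprodClosed P) {D : ℕ → C} (φ : ∀ k, D k ⟶ D (k + 1))
    (hφ : ∀ k, ∃ (K : C) (a : K ⟶ D k) (b : D (k + 1) ⟶ K⟦(1 : ℤ)⟧),
      Triangle.mk a (φ k) b ∈ distTriang C ∧ P K)
    (h0 : ∀ X, compacts C X → ∃ N, ∀ k ≥ N, ∀ f : X ⟶ D k, f ≫ φ k = 0) :
    ObjectProperty.extensionProduct P (P.shift (-1 : ℤ)) (D 0) := by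
  obtain ⟨hcop, ι, S, hS, hgen⟩ := hC
  have : HasCoproducts.{0} C := hasCoproducts_shrink.{0, v}
  choose K a b hT hK using exists_fibre_fromZero hP φ hφ
  obtain ⟨c, hc, h, F, G, hF, -, hinj⟩ : ∃ (c : Cofan D) (_ : IsColimit c)
      (h : ∐ K ⟶ ∐ fun _ : ℕ => D 0) (F : (∐ fun _ : ℕ => D 0) ⟶ c.pt) (G : c.pt ⟶ (∐ K)⟦(1 : ℤ)⟧),
      Triangle.mk h F G ∈ distTriang C ∧
      (∀ j, Sigma.ι K j ≫ h = a j ≫ Sigma.ι (fun _ : ℕ => D 0) j) ∧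
      ∀ j, Sigma.ι (fun _ : ℕ => D 0) j ≫ F = fromZero φ j ≫ c.inj j :=
    exists_coproduct_triangle hT _ (coproductIsCoproduct K) _
      (coproductIsCoproduct fun _ : ℕ => D 0)
  -- the homotopy colimit vanishes, so `1 - shift` is invertible
  have hiso : IsIso (oneSubShift φ hc) := by
    obtain ⟨H, p, δ, hH⟩ := distinguished_cocone_triangle (oneSubShift φ hc)
    refine (Triangle.isZero₃_iff_isIso₁ _ hH).1 (hgen H fun i n f => ?_)
    have hX := compacts_shift (hS i) n
    obtain ⟨N, hN⟩ := h0 _ hX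
    obtain ⟨k, hk, g, rfl⟩ := exists_factor_hocolim φ hc hH hX f N
    have := c.inj k ≫= dist_zero₁₂ hH
    rw [inj_oneSubShift_assoc, Preadditive.sub_comp, comp_zero, sub_eq_zero,
      Category.assoc] at this
    rw [this, reassoc_of% hN k hk g, zero_comp]
  -- `D 0` is the homotopy colimit of its constant sequence, and `F ≫ (1 - shift)` has cone `ΣK`
  -- up to isomorphism; the octahedron compares the three cones
  let c₀ : Cofan fun _ : ℕ => D 0 := Cofan.mk _ (Sigma.ι fun _ : ℕ => D 0)
  have hc₀ : IsColimit c₀ := coproductIsCoproduct _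
  have hcomm : oneSubShift (fun _ => 𝟙 (D 0)) hc₀ ≫ F = F ≫ oneSubShift φ hc := by
    refine Cofan.IsColimit.hom_ext hc₀ _ _ fun k => ?_
    have hinj' : ∀ j, c₀.inj j ≫ F = fromZero φ j ≫ c.inj j := hinj
    rw [inj_oneSubShift_assoc, reassoc_of% hinj', inj_oneSubShift, Preadditive.sub_comp,
      Category.id_comp, hinj', hinj', Preadditive.comp_sub, fromZero, Category.assoc]
  obtain ⟨H, p, δ, hH⟩ := distinguished_cocone_triangle (oneSubShift (fun _ => 𝟙 (D 0)) hc₀)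
  obtain ⟨e⟩ := nonempty_iso_hocolim_const hc₀ hH
  obtain ⟨G', hG'⟩ := exists_rotated_triangle hF
  obtain ⟨W, q, r, hW⟩ := distinguished_cocone_triangle (F ≫ oneSubShift φ hc)
  have hPK : P (∐ K) :=
    hP.coproduct_small K _ (coproductIsCoproduct K) hK
  let e₂ : c.pt ≅ c.pt := asIso (oneSubShift φ hc)
  have e' : (∐ K)⟦(1 : ℤ)⟧ ≅ W := Triangle.π₃.mapIso (isoTriangleOfIso₁₂ _ _ hG' hW (Iso.refl _)
    e₂ (Category.id_comp _).symm)
  have hW' : P.shift (-1 : ℤ) W :=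
    (hP.shift _).of_iso e' (hP.of_iso (shiftShiftNeg (∐ K) (1 : ℤ)).symm hPK)
  obtain ⟨x, y, hxy⟩ := exists_fibre_triangle (Triangulated.someOctahedron hcomm hH hG' hW).mem
  have := hP.isClosedUnderIsomorphisms
  exact ObjectProperty.prop_of_iso _ e.symm
    ⟨_, _, _, _, _, hxy, hP.of_iso (shiftShiftNeg (∐ K) (1 : ℤ)).symm hPK, hW'⟩

/-- Towers built step by step: it suffices that every object at level `k` maps to an object at
level `k + 1` with fibre in `P`, by a map that eventually kills all maps from compact objects. -/
lemma extensionProduct_of_step [IsTriangulated C] (hC : IsCompactlyGenerated C)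
    {P : ObjectProperty C} (hP : IsCoprodClosed P) (Q : ℕ → ObjectProperty C) (N : C → ℕ)
    (step : ∀ k X, Q k X → ∃ (K Y : C) (a : K ⟶ X) (g : X ⟶ Y) (b : Y ⟶ K⟦(1 : ℤ)⟧),
      Triangle.mk a g b ∈ distTriang C ∧ P K ∧ Q (k + 1) Y ∧
        ∀ G, compacts C G → N G ≤ k → ∀ f : G ⟶ X, f ≫ g = 0)
    {X : C} (hX : Q 0 X) : ObjectProperty.extensionProduct P (P.shift (-1 : ℤ)) X := by
  choose K Y a g b hT hK hY h0 using step
  let D : ∀ k, { X // Q k X } := Nat.rec ⟨X, hX⟩ fun k X => ⟨Y k X.1 X.2, hY k X.1 X.2⟩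
  exact extensionProduct_of_tower hC hP (D := fun k => (D k).1)
    (fun k => g k (D k).1 (D k).2) (fun k => ⟨_, _, _, hT k _ _, hK k _ _⟩)
    fun G hG => ⟨N G, fun k hk f => h0 k _ _ G hG hk f⟩

/-- A class closed under coproducts, extensions and suspension is closed under direct summands:
if `X ⊞ X'` is in the class, the tower of zero maps `X ⟶ X'⟦1⟧ ⟶ X⟦2⟧ ⟶ ⋯` has fibres
in the class. -/
lemma IsCoprodClosed.of_retract [IsTriangulated C] (hC : IsCompactlyGenerated C)
    {P : ObjectProperty C} (hP : IsCoprodClosed P) (hs : P ≤ P.shift (1 : ℤ)) {X Z : C}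
    (r : Retract X Z) (hZ : P Z) : P X := by
  have key : ObjectProperty.extensionProduct P (P.shift (-1 : ℤ)) X := by
    refine extensionProduct_of_step hC hP (fun _ X => ∃ X', P (X' ⊞ X)) (fun _ => 0) ?_ ?_
    · rintro - X ⟨X', h⟩
      obtain ⟨c, hc⟩ := exists_rotated_triangle (binaryBiproductTriangle_distinguished X' X)
      refine ⟨_, _, _, _, _, hc, h, ⟨X⟦(1 : ℤ)⟧, ?_⟩, fun _ _ _ f => comp_zero⟩
      have := preservesBinaryBiproducts_of_preservesBiproducts (shiftFunctor C (1 : ℤ))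
      exact hP.of_iso ((shiftFunctor C (1 : ℤ)).mapBiprod X' X ≪≫ biprod.braiding _ _) (hs _ h)
    · obtain ⟨X', g, h, hT⟩ := distinguished_cocone_triangle r.i
      have : h = 0 := Triangle.mor₃_eq_zero_of_mono₁ _ hT (inferInstanceAs (Mono r.i))
      obtain ⟨e, -, -⟩ := exists_iso_binaryBiproduct_of_distTriang _ hT this
      exact ⟨X', hP.of_iso (e ≪≫ biprod.braiding _ _) hZ⟩
  obtain ⟨Y, Z, f, g, h, hT, hY, hZ⟩ := key
  exact hP.extension _ hT hY (hP.of_iso (shiftNegShift Z (1 : ℤ)) (hs _ hZ))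

end Tower

/-! ### Finite extensions and the compact objects of a double orthogonal -/

section

variable {C : Type u} [Category.{v} C] [Preadditive C]

lemma compacts_of_retract {X Z : C} (r : Retract X Z) (hZ : compacts C Z) : compacts C X := by
  intro J Y c hc f
  obtain ⟨s, g, hg⟩ := hZ Y c hc (r.r ≫ f)
  refine ⟨s, fun j => r.i ≫ g j, ?_⟩
  simp only [Category.assoc, ← Preadditive.comp_sum, ← hg, r.retract_assoc]

lemma leftOrthogonal_of_retract {P : ObjectProperty C} {X Z : C} (r : Retract X Z)
    (hZ : P.leftOrthogonal Z) : P.leftOrthogonal X := fun A f hA => by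
  rw [← r.retract_assoc f, hZ (r.r ≫ f) hA, comp_zero]

lemma le_leftOrthogonal_rightOrthogonal (P : ObjectProperty C) :
    P ≤ P.rightOrthogonal.leftOrthogonal := fun _ hX _ f hY => hY f hX

end

section FiniteCoproducts

variable {C : Type u} [Category.{v} C] [HasZeroObject C] [HasShift C ℤ] [Preadditive C]
  [∀ n : ℤ, (shiftFunctor C n).Additive] [Pretriangulated C]

/-- A property closed under isomorphisms, zero objects and extensions. -/
structure IsExtensionClosed (Q : ObjectProperty C) : Prop where
  of_iso {X Y : C} (e : X ≅ Y) (hX : Q X) : Q Y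
  of_isZero {X : C} (hX : IsZero X) : Q X
  extension (D : Triangle C) (hD : D ∈ distTriang C) (h₁ : Q D.obj₁) (h₃ : Q D.obj₃) : Q D.obj₂

lemma IsCoprodClosed.isExtensionClosed {Q : ObjectProperty C} (hQ : IsCoprodClosed Q) :
    IsExtensionClosed Q :=
  ⟨hQ.of_iso, hQ.of_isZero, hQ.extension⟩

namespace IsExtensionClosed

variable {Q : ObjectProperty C} (hQ : IsExtensionClosed Q)

include hQ

lemma biprod {X Y : C} (hX : Q X) (hY : Q Y) : Q (X ⊞ Y) :=
  hQ.extension _ (binaryBiproductTriangle_distinguished X Y) hX hY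

lemma coproduct {J : Type} [Finite J] (Y : J → C) (c : Cofan Y) (hc : IsColimit c)
    (h : ∀ j, Q (Y j)) : Q c.pt := by
  have key : ∀ (J : Type) [Finite J] (Y : J → C), (∀ j, Q (Y j)) →
      ∃ (c : Cofan Y) (_ : IsColimit c), Q c.pt := by
    intro J _
    induction J using Finite.induction_empty_option with
    | of_equiv e ih =>
      intro Y hY
      obtain ⟨c, hc, h⟩ := ih (fun j => Y (e j)) fun j => hY _
      refine ⟨Cofan.mk c.pt fun j => eqToHom (by simp) ≫ c.inj (e.symm j), ?_, h⟩
      refine Cofan.IsColimit.mk _ (fun s => Cofan.IsColimit.desc hc fun j => s.inj (e j)) ?_ ?_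
      · intro s j
        obtain ⟨j, rfl⟩ := e.surjective j
        have : ∀ (i j) (h : i = j) (h' : Y (e j) = Y (e i)),
            eqToHom h' ≫ s.inj (e i) = s.inj (e j) := by
          rintro i _ rfl h'
          simp
        rw [cofan_mk_inj, Category.assoc, Cofan.IsColimit.fac]
        exact this _ _ (by simp) _
      · intro s m hm
        refine Cofan.IsColimit.hom_ext hc _ _ fun j => ?_
        have := hm (e j)
        have h' : ∀ (i j) (h : i = j) (h' : Y (e j) = Y (e i)),
            eqToHom h' ≫ c.inj i = c.inj j := by
          rintro i _ rfl h'
          simp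
        rw [cofan_mk_inj, h' _ j (by simp)] at this
        rw [this, Cofan.IsColimit.fac]
    | h_empty =>
      intro Y _
      exact ⟨Cofan.mk 0 fun j => j.elim, Cofan.IsColimit.mk _ (fun _ => 0) (fun _ j => j.elim)
        fun _ _ _ => (isZero_zero C).eq_of_src _ _, hQ.of_isZero (isZero_zero C)⟩
    | h_option ih =>
      intro Y hY
      obtain ⟨c, hc, h⟩ := ih (fun j => Y (some j)) fun j => hY _
      refine ⟨Cofan.mk (Y none ⊞ c.pt) fun j => match j with
        | none => biprod.inl
        | some j => c.inj j ≫ biprod.inr, ?_, hQ.biprod (hY none) h⟩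
      refine Cofan.IsColimit.mk _ (fun s => biprod.desc (s.inj none)
        (Cofan.IsColimit.desc hc fun j => s.inj (some j))) ?_ ?_
      · rintro s (_ | j)
        · simp
        · simp
      · intro s m hm
        refine biprod.hom_ext' _ _ ?_ (Cofan.IsColimit.hom_ext hc _ _ fun j => ?_)
        · simpa using hm none
        · simpa using hm (some j)
  obtain ⟨c', hc', h'⟩ := key J Y h
  exact hQ.of_iso (hc'.coconePointUniqueUpToIso hc) h'

end IsExtensionClosed

lemma finiteCoprodClosure_le {P Q : ObjectProperty C} (hQ : IsExtensionClosed Q) (h : P ≤ Q) :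
    finiteCoprodClosure P ≤ Q := by
  intro X hX
  induction hX with
  | of X hX => exact h X hX
  | coproduct Y c hc _ ih => exact hQ.coproduct Y c hc ih
  | extension D hD _ _ ih₁ ih₃ => exact hQ.extension D hD ih₁ ih₃

lemma finiteCoprodClosure_isExtensionClosed (P : ObjectProperty C) :
    IsExtensionClosed (finiteCoprodClosure P) where
  of_iso {X _} e hX :=
    .coproduct (fun _ : Unit => X) _ (Cofan.isColimitMkOfUnique e Unit) fun _ => hX
  of_isZero {X} hX := .coproduct (J := Empty) (fun j => j.elim) (Cofan.mk X fun j => j.elim)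
    (Cofan.IsColimit.mk _ (fun _ => 0) (fun _ j => j.elim) fun _ _ _ => hX.eq_of_src _ _)
    fun j => j.elim
  extension D hD h₁ h₃ := .extension D hD h₁ h₃

lemma smdCoprod_isExtensionClosed (P : ObjectProperty C) : IsExtensionClosed (smdCoprod P) where
  of_iso e hX := ObjectProperty.prop_of_iso (ObjectProperty.retractClosure _) e hX
  of_isZero hX := ObjectProperty.le_retractClosure _ _
    ((finiteCoprodClosure_isExtensionClosed P).of_isZero hX)
  extension D hD h₁ h₃ := ObjectProperty.monotone_retractClosure
    (Q := finiteCoprodClosure P) (by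
      rintro X ⟨_, _, _, _, _, hT, hY, hZ⟩
      exact .extension _ hT hY hZ) _
    (ObjectProperty.extensionProduct_retractClosure_retractClosure_le _ _ _
      ⟨_, _, _, _, _, hD, h₁, h₃⟩)

lemma le_smdCoprod (P : ObjectProperty C) : P ≤ smdCoprod P := fun X hX =>
  ObjectProperty.le_retractClosure _ _ (.of X hX)

lemma smdCoprod_le {P Q : ObjectProperty C} (hQ : IsExtensionClosed Q)
    (hr : ∀ {X Z : C}, Retract X Z → Q Z → Q X) (h : P ≤ Q) : smdCoprod P ≤ Q := by
  rintro X ⟨Z, hZ, ⟨r⟩⟩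
  exact hr r (finiteCoprodClosure_le hQ h Z hZ)

lemma smdCoprod_le_smdCoprod {P Q : ObjectProperty C} (h : P ≤ smdCoprod Q) :
    smdCoprod P ≤ smdCoprod Q :=
  smdCoprod_le (smdCoprod_isExtensionClosed Q)
    (fun r hZ => (ObjectProperty.retractClosure _).prop_of_retract r hZ) h

lemma compacts_isExtensionClosed : IsExtensionClosed (compacts C) where
  of_iso e hX := ObjectProperty.prop_of_iso _ e hX
  of_isZero hX := by
    obtain ⟨Z, hZ, h⟩ := (compacts C).exists_prop_of_containsZero
    exact ObjectProperty.prop_of_iso _ (hZ.iso hX) h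
  extension D hD h₁ h₃ := (compacts C).ext_of_isTriangulatedClosed₂ D hD h₁ h₃

lemma smdCoprod_le_compacts {P : ObjectProperty C} (h : P ≤ compacts C) :
    smdCoprod P ≤ compacts C :=
  smdCoprod_le compacts_isExtensionClosed compacts_of_retract h

lemma smdCoprod_le_leftOrthogonal {P Q : ObjectProperty C} (h : P ≤ Q.leftOrthogonal) :
    smdCoprod P ≤ Q.leftOrthogonal :=
  smdCoprod_le (IsCoprodClosed.leftOrthogonal Q).isExtensionClosed leftOrthogonal_of_retract h

lemma rightOrthogonal_smdCoprod (P : ObjectProperty C) :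
    (smdCoprod P).rightOrthogonal = P.rightOrthogonal := by
  ext Y
  exact ⟨fun h X f hX => h f (le_smdCoprod P X hX), fun h X f hX =>
    smdCoprod_le_leftOrthogonal (le_leftOrthogonal_rightOrthogonal P) X hX f h⟩

/-- A map from a compact object to an object built from compacts by coproducts and extensions
only sees a finite part of the construction. -/
lemma exists_factor_finiteCoprodClosure {P : ObjectProperty C} (hP : P ≤ compacts C) {W : C}
    (hW : coprodClosure P W) {X : C} (hX : compacts C X) (f : X ⟶ W) :
    ∃ (Z : C) (_ : finiteCoprodClosure P Z) (a : X ⟶ Z) (b : Z ⟶ W), f = a ≫ b := by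
  induction hW generalizing X with
  | of W hW => exact ⟨W, .of W hW, f, 𝟙 W, (Category.comp_id f).symm⟩
  | coproduct Y c hc _ ih =>
    classical
    obtain ⟨s, g, rfl⟩ := hX Y c hc f
    induction s using Finset.induction_on with
    | empty =>
      exact ⟨0, (finiteCoprodClosure_isExtensionClosed P).of_isZero (isZero_zero C), 0, 0, by simp⟩
    | insert j s hj ihs =>
      obtain ⟨Z, hZ, a, b, hab⟩ := ihs
      obtain ⟨Z', hZ', a', b', hab'⟩ := ih j hX (g j)
      refine ⟨Z' ⊞ Z, (finiteCoprodClosure_isExtensionClosed P).biprod hZ' hZ,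
        biprod.lift a' a, biprod.desc (b' ≫ c.inj j) b, ?_⟩
      rw [Finset.sum_insert hj, hab, hab', biprod.lift_desc, Category.assoc]
  | extension D hD _ _ ih₁ ih₃ =>
    obtain ⟨Z₂, hZ₂, a, b, hab⟩ := ih₃ hX (f ≫ D.mor₂)
    obtain ⟨K, k, w, hT⟩ := distinguished_cocone_triangle₁ a
    have hK : compacts C K := (compacts C).ext_of_isTriangulatedClosed₁ _ hT hX
      (finiteCoprodClosure_le compacts_isExtensionClosed hP _ hZ₂)
    obtain ⟨u, hu₁, hu₂⟩ : ∃ u : K ⟶ D.obj₁, k ≫ f = u ≫ D.mor₁ ∧ w ≫ u⟦(1 : ℤ)⟧' = b ≫ D.mor₃ :=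
      complete_distinguished_triangle_morphism₁ _ D hT hD f b hab.symm
    obtain ⟨Z₁, hZ₁, u₁, u₂, rfl⟩ := ih₁ hK u
    obtain ⟨X', z₁, z₂, hT'⟩ := distinguished_cocone_triangle₂ (w ≫ u₁⟦(1 : ℤ)⟧')
    obtain ⟨c, hc₁, hc₂⟩ : ∃ c : X ⟶ X', k ≫ c = u₁ ≫ z₁ ∧ a ≫ 𝟙 Z₂ = c ≫ z₂ :=
      complete_distinguished_triangle_morphism₂ _ _ hT hT' u₁ (𝟙 Z₂) (Category.id_comp _).symm
    obtain ⟨c', hc'₁, -⟩ : ∃ c' : X' ⟶ D.obj₂, z₁ ≫ c' = u₂ ≫ D.mor₁ ∧ z₂ ≫ b = c' ≫ D.mor₂ :=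
      complete_distinguished_triangle_morphism₂ _ D hT' hD u₂ b (by
        rw [Functor.map_comp, ← Category.assoc] at hu₂
        exact hu₂)
    -- `f` and `c ≫ c'` agree on the fibre of `X ⟶ Z₂`; their difference corrects `c'`
    obtain ⟨e, he⟩ := dist_desc₂ hT (f - c ≫ c') (by
      rw [Preadditive.comp_sub, hu₁, reassoc_of% hc₁, hc'₁, Category.assoc, sub_self])
    refine ⟨X', .extension _ hT' hZ₁ hZ₂, c, c' + z₂ ≫ e, ?_⟩
    rw [Preadditive.comp_add, ← reassoc_of% hc₂, ← he]
    simp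

/-- The finite-stage form of the small object argument: maps from a compact object to an object
of `⊥(S⊥)` factor through a finite extension of objects of `S`. Killing all maps from `S`
transfinitely sends `X` to an object of `S⊥`, hence by the zero map; a given map from a compact
object is already killed at a finite stage. -/
lemma exists_factor_of_leftOrthogonal [IsTriangulated C] [HasCoproducts.{v} C] {ι : Type v}
    {S : ι → C} (hS : ∀ i, compacts C (S i)) {X : C}
    (hX : (ObjectProperty.ofObj S).rightOrthogonal.leftOrthogonal X) {G : C} (hG : compacts C G)
    (f : G ⟶ X) :
    ∃ (Z : C) (_ : finiteCoprodClosure (.ofObj S) Z) (a : G ⟶ Z) (b : Z ⟶ X), f = a ≫ b := by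
  have : HasCoproducts.{0} C := hasCoproducts_shrink.{0, v}
  have step : ∀ Y : C, ∃ (K Y' : C) (a : K ⟶ Y) (g : Y ⟶ Y') (b : Y' ⟶ K⟦(1 : ℤ)⟧),
      Triangle.mk a g b ∈ distTriang C ∧ coprodClosure (.ofObj S) K ∧
        ∀ i (f : S i ⟶ Y), f ≫ g = 0 := by
    intro Y
    let F : (Σ i, S i ⟶ Y) → C := fun x => S x.1
    obtain ⟨Y', g, b, hT⟩ := distinguished_cocone_triangle (Sigma.desc fun x : Σ i, S i ⟶ Y => x.2)
    refine ⟨_, Y', _, g, b, hT, .coproduct F _ (coproductIsCoproduct F) fun x =>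
      .of _ (ObjectProperty.ofObj_apply S x.1), fun i f => ?_⟩
    have h : Sigma.ι F ⟨i, f⟩ ≫ (Sigma.desc fun x : Σ i, S i ⟶ Y => x.2) = f := Sigma.ι_desc _ _
    rw [← h, Category.assoc, dist_zero₁₂ hT, comp_zero]
  choose K Y a g b hT hK h0 using step
  obtain ⟨D, φ, rfl, hφ, h0⟩ : ∃ (D : ℕ → C) (φ : ∀ k, D k ⟶ D (k + 1)), X = D 0 ∧
      (∀ k, ∃ (K : C) (a : K ⟶ D k) (b : D (k + 1) ⟶ K⟦(1 : ℤ)⟧),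
        Triangle.mk a (φ k) b ∈ distTriang C ∧ coprodClosure (.ofObj S) K) ∧
      ∀ k i (f : S i ⟶ D k), f ≫ φ k = 0 :=
    ⟨fun k => Nat.rec X (fun _ => Y) k, fun k => g _, rfl, fun k => ⟨_, _, _, hT _, hK _⟩,
      fun k => h0 _⟩
  let c : Cofan D := Cofan.mk (∐ D) (Sigma.ι D)
  have hc : IsColimit c := coproductIsCoproduct D
  obtain ⟨H, p, δ, hH⟩ := distinguished_cocone_triangle
    (oneSubShift φ hc)
  have hι : c.inj 0 ≫ p = 0 := by
    refine hX _ fun A f hA => ?_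
    obtain ⟨i⟩ := hA
    obtain ⟨k, -, f', rfl⟩ := exists_factor_hocolim φ _ hH (hS i) f 0
    have := c.inj k ≫= dist_zero₁₂ hH
    rw [inj_oneSubShift_assoc, Preadditive.sub_comp, comp_zero, sub_eq_zero,
      Category.assoc] at this
    rw [this, ← Category.assoc, h0 _ i f', zero_comp]
  obtain ⟨m, hm⟩ := exists_fromZero_eq_zero_of_hocolim φ _ hH hG f (by rw [hι, comp_zero])
  obtain ⟨L, a', b', hL, hL'⟩ := exists_fibre_fromZero
    (coprodClosure_isCoprodClosed (.ofObj S)) φ hφ m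
  obtain ⟨f', rfl⟩ := dist_lift₂ hL f hm
  obtain ⟨Z, hZ, x, y, rfl⟩ := exists_factor_finiteCoprodClosure (by
    rintro _ ⟨i⟩
    exact hS i) hL' hG f'
  exact ⟨Z, hZ, x, y ≫ a', Category.assoc _ _ _⟩

end FiniteCoproducts

/-! ### Approximation triangles and closures of compacts -/

section Core

open ObjectProperty

variable {C : Type u} [Category.{v} C] [HasShift C ℤ]

lemma isStableUnderShift_of_one {P : ObjectProperty C} [P.IsClosedUnderIsomorphisms]
    (h₁ : P ≤ P.shift (1 : ℤ)) (h₂ : P ≤ P.shift (-1 : ℤ)) : P.IsStableUnderShift ℤ where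
  isStableUnderShiftBy n := ⟨by
    induction n using Int.induction_on with
    | zero => exact fun X hX => P.prop_of_iso ((shiftFunctorZero C ℤ).app X).symm hX
    | succ n ih =>
      exact fun X hX => P.prop_of_iso ((shiftFunctorAdd' C (n : ℤ) 1 (n + 1) rfl).app X).symm
        (h₁ _ (ih X hX))
    | pred n ih =>
      exact fun X hX => P.prop_of_iso
        ((shiftFunctorAdd' C (-n : ℤ) (-1) (-n - 1) (by ring)).app X).symm (h₂ _ (ih X hX))⟩

variable [HasZeroObject C] [Preadditive C] [∀ n : ℤ, (shiftFunctor C n).Additive]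
  [Pretriangulated C]

/-- Maps from `X ∈ U` to the first vertex of a triangle `X' ⟶ F ⟶ Y'` with `Y'` and `Y'⟦-1⟧`
right orthogonal to `U` are detected in `F`. -/
lemma eq_zero_of_comp_eq_zero {X X' F Y' : C} {f : X' ⟶ F} {g : F ⟶ Y'} {h : Y' ⟶ X'⟦(1 : ℤ)⟧}
    (hT : Triangle.mk f g h ∈ distTriang C) (h0 : ∀ a : X ⟶ Y'⟦(-1 : ℤ)⟧, a = 0) (a : X ⟶ X')
    (ha : a ≫ f = 0) : a = 0 := by
  obtain ⟨x, y, hxy⟩ := exists_fibre_triangle hT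
  obtain ⟨b, rfl⟩ := dist_lift₂ hxy a ha
  rw [h0 b, zero_comp]

/-- The first vertex of a triangle `X ⟶ F ⟶ Y` with `X ∈ U`, `Y ∈ V` and no maps from `U` to `V`
is unique. -/
lemma nonempty_iso_of_triangles {U V : ObjectProperty C}
    (hUV : ∀ ⦃X Y : C⦄ (f : X ⟶ Y), U X → V Y → f = 0) (hV : V ≤ V.shift (-1 : ℤ))
    {F X Y X' Y' : C} {f : X ⟶ F} {g : F ⟶ Y} {h : Y ⟶ X⟦(1 : ℤ)⟧}
    {f' : X' ⟶ F} {g' : F ⟶ Y'} {h' : Y' ⟶ X'⟦(1 : ℤ)⟧}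
    (hT : Triangle.mk f g h ∈ distTriang C) (hT' : Triangle.mk f' g' h' ∈ distTriang C)
    (hX : U X) (hY : V Y) (hX' : U X') (hY' : V Y') : Nonempty (X ≅ X') := by
  obtain ⟨u, hu⟩ := dist_lift₂ hT' f (hUV _ hX hY')
  obtain ⟨u', hu'⟩ := dist_lift₂ hT f' (hUV _ hX' hY)
  refine ⟨⟨u, u', ?_, ?_⟩⟩
  · rw [← sub_eq_zero]
    refine eq_zero_of_comp_eq_zero hT (fun a => hUV a hX (hV _ hY)) _ ?_
    rw [Preadditive.sub_comp, Category.assoc, ← hu', ← hu, Category.id_comp, sub_self]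
  · rw [← sub_eq_zero]
    refine eq_zero_of_comp_eq_zero hT' (fun a => hUV a hX' (hV _ hY')) _ ?_
    rw [Preadditive.sub_comp, Category.assoc, ← hu, ← hu', Category.id_comp, sub_self]

/-- Right admissibility of `U` in `S` from approximation triangles. -/
lemma isRightAdmissibleIn_of_triangles {U S : ObjectProperty C} (hUS : U ≤ S)
    [S.IsTriangulated] [U.IsClosedUnderIsomorphisms] [U.IsTriangulated]
    (h : ∀ F, S F → ∃ (X Y : C) (f : X ⟶ F) (g : F ⟶ Y) (h : Y ⟶ X⟦(1 : ℤ)⟧),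
      Triangle.mk f g h ∈ distTriang C ∧ U X ∧
        ∀ Z, U Z → (∀ a : Z ⟶ Y, a = 0) ∧ ∀ a : Z ⟶ Y⟦(-1 : ℤ)⟧, a = 0) :
    IsRightAdmissibleIn U S := by
  refine ⟨hUS, inferInstance, ⟨⟨inferInstance, inferInstance⟩, ?_⟩⟩
  rw [isLeftAdjoint_iff_hasTerminal_costructuredArrow]
  rintro ⟨F, hF⟩
  obtain ⟨X, Y, f, g, w, hT, hX, h0⟩ := h F hF
  let X' : (U.inverseImage S.ι).FullSubcategory := ⟨⟨X, hUS _ hX⟩, hX⟩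
  let t : CostructuredArrow (U.inverseImage S.ι).ι ⟨F, hF⟩ :=
    CostructuredArrow.mk (Y := X') (S.homMk f)
  have key : ∀ (s : CostructuredArrow (U.inverseImage S.ι).ι ⟨F, hF⟩),
      ∃ k : s.left.1.1 ⟶ X, s.hom.hom = k ≫ f := fun s =>
    dist_lift₂ hT _ ((h0 _ s.left.2).1 _)
  choose k hk using key
  refine IsTerminal.hasTerminal (X := t) (IsTerminal.ofUniqueHom
    (fun s => CostructuredArrow.homMk ((U.inverseImage S.ι).homMk (S.homMk (k s)))
      (InducedCategory.hom_ext (hk s).symm)) fun s m => ?_)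
  refine CostructuredArrow.hom_ext _ _ (InducedCategory.hom_ext (InducedCategory.hom_ext ?_))
  change m.left.hom.hom = k s
  rw [← sub_eq_zero]
  refine eq_zero_of_comp_eq_zero hT (h0 _ s.left.2).2 _ ?_
  have := congr_arg InducedCategory.Hom.hom (CostructuredArrow.w m)
  rw [Preadditive.sub_comp, ← hk, sub_eq_zero]
  exact this

/-- The properties of a metric on `C` that control closures of compacts: coproduct-closed layers
that are eventually right orthogonal to any given compact object. -/
structure IsCompactlyVanishing (R : ℤ → ObjectProperty C) : Prop extends
    IsExtendedGoodMetric R where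
  coprodClosed : ∀ n, IsCoprodClosed (R n)
  vanishing : ∀ X, compacts C X → ∃ N : ℤ, ∀ i ≥ N, ∀ Y, R i Y → ∀ f : X ⟶ Y, f = 0

lemma IsExtendedGoodMetric.antitone {R : ℤ → ObjectProperty C} (hR : IsExtendedGoodMetric R) :
    Antitone R :=
  antitone_int_of_succ_le hR.succ_le

section ClosureOfCompacts

variable {R : ℤ → ObjectProperty C} (hR : IsCompactlyVanishing R)

instance : (closureOfCompacts R).IsClosedUnderIsomorphisms where
  of_iso e h n := prop_of_iso _ e (h n)

include hR

lemma compacts_le_closureOfCompacts : compacts C ≤ closureOfCompacts R := fun X hX n =>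
  haveI := hR.containsZero n
  le_extensionProduct_left (R n) X hX

/-- For an extension with third vertex approximated by a compact object `E`, a sufficiently good
approximation of the first vertex has error term right orthogonal to `E`, so that the two
approximations can be rearranged into one of the middle vertex. -/
lemma closureOfCompacts_isTriangulated [IsTriangulated C] :
    (closureOfCompacts R).IsTriangulated where
  exists_zero := ⟨0, isZero_zero C, compacts_le_closureOfCompacts hR _
    (compacts_isExtensionClosed.of_isZero (isZero_zero C))⟩
  toIsStableUnderShift := isStableUnderShift_of_one
    (fun X hX n => by
      obtain ⟨Y, Z, f, g, h, hT, hY, hZ⟩ := hX (n + 1)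
      exact ⟨_, _, _, _, _, Triangle.shift_distinguished _ hT 1, compacts_shift hY 1,
        hR.shift_one n Z hZ⟩)
    (fun X hX n => by
      obtain ⟨Y, Z, f, g, h, hT, hY, hZ⟩ := hX (n + 1)
      exact ⟨_, _, _, _, _, Triangle.shift_distinguished _ hT (-1), compacts_shift hY (-1),
        hR.shift_neg_one n Z hZ⟩)
  toIsTriangulatedClosed₂ := .mk' fun T hT h₁ h₃ n => by
    obtain ⟨E, D, f, g, h, hT₃, hE, hD⟩ := h₃ n
    -- approximate the first vertex so well that the compact part `E` of the third is orthogonal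
    obtain ⟨N, hN⟩ := hR.vanishing E hE
    let m := max n (N + 1)
    have hm : R m ≤ R (m - 1 + 1) := by rw [sub_add_cancel]
    have := extensionProduct_extensionProduct_le (U := compacts C) (V := R m) (U' := .singleton E)
      (V' := R n) (by
        rintro _ Y f ⟨_⟩ hY
        exact hN (m - 1) (by have := le_max_right n (N + 1); omega) _
          (hR.shift_one _ _ (hm _ hY)) f) T.obj₂
      ⟨_, _, _, _, _, hT, h₁ m, _, _, _, _, _, hT₃, by simp, hD⟩
    refine monotone_extensionProduct_left _ ?_ _ (monotone_extensionProduct_right _ ?_ _ this)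
    · exact extensionProduct_le_of_isTriangulatedClosed₂ le_rfl (by simpa using hE)
    · exact extensionProduct_le (hR.coprodClosed n) (hR.antitone (le_max_left _ _)) le_rfl

lemma extensionProduct_closureOfCompacts [IsTriangulated C] {F : C} (hF : closureOfCompacts R F)
    (n : ℤ) : extensionProduct (compacts C) (closureOfCompacts R ⊓ R n) F := by
  have := closureOfCompacts_isTriangulated hR
  obtain ⟨E, D, f, g, h, hT, hE, hD⟩ := hF n
  exact ⟨E, D, f, g, h, hT, hE, (closureOfCompacts R).ext_of_isTriangulatedClosed₃ _ hT
    (compacts_le_closureOfCompacts hR _ hE) hF, hD⟩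

/-- Objects of `R n` in the closure of compacts are built from the compact objects of `R n`: they
are the first stage of a tower `D ⟶ D₁ ⟶ D₂ ⟶ ⋯` with compact fibres and `Dₖ ∈ R (n + k)`. -/
lemma closureOfCompacts_inf_le [IsTriangulated C] (hC : IsCompactlyGenerated C)
    {P : ObjectProperty C} (hP : IsCoprodClosed P) {n : ℤ} (h : compacts C ⊓ R n ≤ P) :
    closureOfCompacts R ⊓ R n ≤ extensionProduct P (P.shift (-1 : ℤ)) := by
  intro X hX
  choose! N hN using hR.vanishing
  refine extensionProduct_of_step hC hP (fun k => closureOfCompacts R ⊓ R (n + k))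
    (fun G => (N G - n).toNat) ?_ (by simpa using hX)
  rintro k X ⟨hX, hX'⟩
  obtain ⟨E, D, f, g, w, hT, hE, hD, hD'⟩ := extensionProduct_closureOfCompacts hR hX (n + k + 1)
  obtain ⟨x, y, hxy⟩ := exists_fibre_triangle hT
  refine ⟨E, D, f, g, w, hT, h _ ⟨hE, hR.antitone (by omega : n ≤ n + k) _
    (hR.extension _ _ hxy (hR.shift_neg_one _ _ hD') hX')⟩, ⟨hD, ?_⟩, fun G hG hk a => ?_⟩
  · rw [Nat.cast_succ, ← add_assoc]
    exact hD'
  · rw [hN G hG (n + k) (by omega) _ hX' a, zero_comp]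

end ClosureOfCompacts

end Core

/-! ### Lifting decompositions of the compact objects -/

section Decomposition

open ObjectProperty

variable {C : Type u} [Category.{v} C] [HasZeroObject C] [HasShift C ℤ] [Preadditive C]
  [∀ n : ℤ, (shiftFunctor C n).Additive] [Pretriangulated C]

lemma coprodClosure_isTriangulated {A : ObjectProperty C} [A.IsTriangulated] :
    ObjectProperty.IsTriangulated (coprodClosure A) where
  exists_zero := (coprodClosure_isCoprodClosed A).containsZero.exists_zero
  isStableUnderShiftBy n := ⟨fun _ hX => coprodClosure_shift n
    (fun Y hY => .of _ (A.le_shift n Y hY)) hX⟩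
  toIsTriangulatedClosed₂ := (coprodClosure_isCoprodClosed A).isTriangulatedClosed₂

instance coprodClosure_isClosedUnderIsomorphisms (A : ObjectProperty C) :
    IsClosedUnderIsomorphisms (coprodClosure A) :=
  (coprodClosure_isCoprodClosed A).isClosedUnderIsomorphisms

/-- A semiorthogonal decomposition `⟨B, A⟩` of the category of compact objects: every compact
object `c` is in a triangle `a ⟶ c ⟶ b` with `a ∈ A` and `b ∈ B`, and there are no maps from `A`
to `B`. -/
structure IsCompactDecomposition (A B : ObjectProperty C) : Prop where
  isTriangulated₁ : A.IsTriangulated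
  isTriangulated₂ : B.IsTriangulated
  le₁ : A ≤ compacts C
  hom_eq_zero : ∀ ⦃X Y : C⦄ (f : X ⟶ Y), A X → B Y → f = 0
  le_extensionProduct : compacts C ≤ extensionProduct A B

variable {A B : ObjectProperty C} (hAB : IsCompactDecomposition A B)

include hAB

lemma IsCompactDecomposition.hom_coprodClosure ⦃X Y : C⦄ (f : X ⟶ Y) (hX : coprodClosure A X)
    (hY : coprodClosure B Y) : f = 0 :=
  hom_coprodClosure_eq_zero hAB.le₁ hAB.hom_eq_zero f hX hY

lemma IsCompactDecomposition.hom_coprodClosure_shift ⦃X Y : C⦄ (n : ℤ) (f : X ⟶ Y⟦n⟧)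
    (hX : coprodClosure A X) (hY : coprodClosure B Y) : f = 0 := by
  have := hAB.isTriangulated₂
  have := coprodClosure_isTriangulated (A := B)
  exact hAB.hom_coprodClosure f hX (le_shift (coprodClosure B) n Y hY)

/-- Boundedness passes to the component in `Coprod(A)`, provided that the left projection
`T^c → A` is continuous for `M`. -/
lemma rightOrthogonal_of_triangle {M M' : ObjectProperty C}
    (hM : M' ≤ extensionProduct (compacts C ⊓ A.leftOrthogonal) (A ⊓ M)) {X F Y : C}
    {f : X ⟶ F} {g : F ⟶ Y} {h : Y ⟶ X⟦(1 : ℤ)⟧} (hT : Triangle.mk f g h ∈ distTriang C)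
    (hX : coprodClosure A X) (hY : coprodClosure B Y) (hF : M.rightOrthogonal F) :
    M'.rightOrthogonal X := by
  intro c a hc
  obtain ⟨c', d, i, p, w, hT', hc', hd⟩ := hM c hc
  obtain ⟨b, rfl⟩ := dist_desc₂ hT' a
    (hom_coprodClosure_eq_zero (A := compacts C ⊓ A.leftOrthogonal) (B := A) inf_le_left
      (fun X Y f hX hY => hX.2 f hY) _ (.of _ hc') hX)
  have : b = 0 := eq_zero_of_comp_eq_zero hT
    (fun a => hAB.hom_coprodClosure_shift (-1) a (.of _ hd.1) hY) b (hF _ hd.2)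
  rw [this, comp_zero]

variable [IsTriangulated C] (hC : IsCompactlyGenerated C)
  {R : ℤ → ObjectProperty C} (hR : IsCompactlyVanishing R)
  (H : ∀ m, ∃ n, compacts C ⊓ R n ≤ extensionProduct (A ⊓ R m) B)

include hC hR H

/-- The projection to `Coprod(A)` is continuous for the metric on the closure of compacts as soon
as the projection `T^c → A` is continuous. -/
lemma closureOfCompacts_inf_le_extensionProduct (m : ℤ) : ∃ n, closureOfCompacts R ⊓ R n ≤
    extensionProduct (coprodClosure A ⊓ R m) (coprodClosure B) := by
  have := hC.1
  have := hAB.isTriangulated₁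
  have := hAB.isTriangulated₂
  have := coprodClosure_isTriangulated (A := A)
  have := coprodClosure_isTriangulated (A := B)
  have hB := coprodClosure_isCoprodClosed B
  have hP : ∀ m, IsCoprodClosed (extensionProduct (coprodClosure A ⊓ R m) (coprodClosure B)) :=
    fun m => ((coprodClosure_isCoprodClosed A).inf (hR.coprodClosed m)).extensionProduct hB
      fun X Y f hX hY => hAB.hom_coprodClosure_shift 1 f hX.1 hY
  have hle : R (m + 1) ≤ R m := hR.succ_le m
  obtain ⟨n, hn⟩ := H (m + 1)
  refine ⟨n, (closureOfCompacts_inf_le hR hC (hP (m + 1)) (hn.trans ?_)).trans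
    (extensionProduct_le (hP m) ?_ ?_)⟩
  · rintro X ⟨_, _, _, _, _, hT, hY, hZ⟩
    exact ⟨_, _, _, _, _, hT, ⟨.of _ hY.1, hY.2⟩, .of _ hZ⟩
  · exact monotone_extensionProduct_left _ (inf_le_inf_left _ hle)
  · rintro X ⟨Y, Z, _, _, _, hT, hY, hZ⟩
    refine (hP m).of_iso (shiftNegShift X (1 : ℤ)) ⟨_, _, _, _, _,
      Triangle.shift_distinguished _ hT 1, ⟨?_, hR.shift_one m _ hY.2⟩, ?_⟩
    · exact le_shift (coprodClosure A) 1 _ hY.1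
    · exact le_shift (coprodClosure B) 1 _ hZ

/-- Objects in the closure of compacts decompose along `⟨Coprod(B), Coprod(A)⟩`, the component
in `Coprod(A)` being again in the closure of compacts. -/
lemma exists_triangle_closureOfCompacts {F : C} (hF : closureOfCompacts R F) :
    ∃ (X Y : C) (f : X ⟶ F) (g : F ⟶ Y) (h : Y ⟶ X⟦(1 : ℤ)⟧), Triangle.mk f g h ∈ distTriang C ∧
      coprodClosure A X ∧ closureOfCompacts R X ∧ coprodClosure B Y := by
  have := hAB.isTriangulated₁
  have := hAB.isTriangulated₂
  have := coprodClosure_isTriangulated (A := B)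
  have key : ∀ m, ∃ (X Y : C) (f : X ⟶ F) (g : F ⟶ Y) (h : Y ⟶ X⟦(1 : ℤ)⟧),
      Triangle.mk f g h ∈ distTriang C ∧
      coprodClosure A X ∧ extensionProduct (compacts C) (R m) X ∧ coprodClosure B Y := by
    intro m
    obtain ⟨n, hn⟩ := closureOfCompacts_inf_le_extensionProduct hAB hC hR H m
    have hF' : extensionProduct (extensionProduct A B)
        (extensionProduct (coprodClosure A ⊓ R m) (coprodClosure B)) F :=
      monotone_extensionProduct_left _ hAB.le_extensionProduct _
        (monotone_extensionProduct_right _ hn _ (extensionProduct_closureOfCompacts hR hF n))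
    obtain ⟨X, Y, f, g, h, hT, hX, hY⟩ := extensionProduct_extensionProduct_le
      (fun X Y f hX hY => hAB.hom_coprodClosure_shift 1 f hX.1 (.of _ hY)) F hF'
    refine ⟨X, Y, f, g, h, hT, ?_, ?_, ?_⟩
    · exact extensionProduct_le (coprodClosure_isCoprodClosed A) (le_coprodClosure A) inf_le_left
        _ hX
    · exact monotone_extensionProduct_left _ hAB.le₁ _
        (monotone_extensionProduct_right _ inf_le_right _ hX)
    · exact extensionProduct_le (coprodClosure_isCoprodClosed B) (le_coprodClosure B) le_rfl _ hY
  obtain ⟨X, Y, f, g, h, hT, hX, -, hY⟩ := key 0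
  refine ⟨X, Y, f, g, h, hT, hX, fun m => ?_, hY⟩
  obtain ⟨X', Y', f', g', h', hT', hX', hX'', hY'⟩ := key m
  obtain ⟨e⟩ := nonempty_iso_of_triangles hAB.hom_coprodClosure
    (le_shift (coprodClosure B) (-1)) hT' hT hX' hY' hX hY
  exact prop_of_iso _ e hX''

end Decomposition

/-! ### Bounded objects in the closure of compacts -/

section BoundedClosure

open ObjectProperty

variable {C : Type u} [Category.{v} C] [HasShift C ℤ]

/-- A decreasing family of properties with `M (n + 1)⟦±1⟧ ⊆ M n`. -/
structure IsShiftFiltration (M : ℤ → ObjectProperty C) : Prop where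
  succ_le : ∀ n, M (n + 1) ≤ M n
  shift_one : ∀ n, M (n + 1) ≤ (M n).shift (1 : ℤ)
  shift_neg_one : ∀ n, M (n + 1) ≤ (M n).shift (-1 : ℤ)

lemma IsShiftFiltration.antitone {M : ℤ → ObjectProperty C} (hM : IsShiftFiltration M) :
    Antitone M :=
  antitone_int_of_succ_le hM.succ_le

variable [Preadditive C]

/-- The objects right orthogonal to some `M n`. -/
def unionRightOrthogonal (M : ℤ → ObjectProperty C) : ObjectProperty C :=
  fun F => ∃ n, (M n).rightOrthogonal F

instance (M : ℤ → ObjectProperty C) : (unionRightOrthogonal M).IsClosedUnderIsomorphisms where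
  of_iso := by
    rintro X Y e ⟨n, hn⟩
    exact ⟨n, prop_of_iso _ e hn⟩

variable [∀ n : ℤ, (shiftFunctor C n).Additive]

lemma rightOrthogonal_shift {P Q : ObjectProperty C} (n : ℤ) (h : P ≤ Q.shift (-n)) {F : C}
    (hF : Q.rightOrthogonal F) : P.rightOrthogonal (F⟦n⟧) := by
  intro X f hX
  refine (shiftFunctor C (-n)).map_injective ?_
  rw [← cancel_mono (shiftShiftNeg F n).hom, Functor.map_zero, zero_comp]
  exact hF _ (h _ hX)

variable [HasZeroObject C] [Pretriangulated C]

lemma IsShiftFiltration.unionRightOrthogonal_isTriangulated {M : ℤ → ObjectProperty C}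
    (hM : IsShiftFiltration M) : (unionRightOrthogonal M).IsTriangulated where
  exists_zero := ⟨0, isZero_zero C, 0, fun X f _ => (isZero_zero C).eq_of_tgt _ _⟩
  toIsStableUnderShift := isStableUnderShift_of_one
    (fun F ⟨n, hn⟩ => ⟨n + 1, rightOrthogonal_shift 1 (hM.shift_neg_one n) hn⟩)
    (fun F ⟨n, hn⟩ => ⟨n + 1, rightOrthogonal_shift (-1) (by simpa using hM.shift_one n) hn⟩)
  toIsTriangulatedClosed₂ := .mk' fun T hT ⟨n, hn⟩ ⟨m, hm⟩ => by
    refine ⟨max n m, ext_of_isTriangulatedClosed₂ _ T hT ?_ ?_⟩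
    · exact fun X f hX => hn f (hM.antitone (le_max_left _ _) _ hX)
    · exact fun X f hX => hm f (hM.antitone (le_max_right _ _) _ hX)

variable [IsTriangulated C]

/-- The continuity properties of the two projections `T^c → A` that are needed to lift the
decomposition of the compact objects to the bounded objects in the closure of compacts. -/
structure IsContinuousDecomposition (A B : ObjectProperty C) (M R : ℤ → ObjectProperty C) :
    Prop extends IsCompactDecomposition A B where
  right : ∀ m, ∃ n, compacts C ⊓ R n ≤ extensionProduct (A ⊓ R m) B
  left : ∀ m, ∃ n, M n ≤ extensionProduct (compacts C ⊓ A.leftOrthogonal) (A ⊓ M m)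

variable (hC : IsCompactlyGenerated C) {A B : ObjectProperty C} {M R : ℤ → ObjectProperty C}
  (hR : IsCompactlyVanishing R) (hM : IsShiftFiltration M)

include hR hM in
lemma bounded_isTriangulated : (closureOfCompacts R ⊓ unionRightOrthogonal M).IsTriangulated := by
  have := closureOfCompacts_isTriangulated hR
  have := hM.unionRightOrthogonal_isTriangulated
  infer_instance

include hC hR in
lemma exists_triangle_bounded (hAB : IsContinuousDecomposition A B M R) {F : C}
    (hF : (closureOfCompacts R ⊓ unionRightOrthogonal M) F) :
    ∃ (X Y : C) (f : X ⟶ F) (g : F ⟶ Y) (h : Y ⟶ X⟦(1 : ℤ)⟧), Triangle.mk f g h ∈ distTriang C ∧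
      (coprodClosure A ⊓ (closureOfCompacts R ⊓ unionRightOrthogonal M)) X ∧
      coprodClosure B Y := by
  obtain ⟨X, Y, f, g, h, hT, hX, hX', hY⟩ := exists_triangle_closureOfCompacts
    hAB.toIsCompactDecomposition hC hR hAB.right hF.1
  obtain ⟨n, hn⟩ := hF.2
  obtain ⟨m, hm⟩ := hAB.left n
  exact ⟨X, Y, f, g, h, hT, ⟨hX, hX', m, rightOrthogonal_of_triangle
    hAB.toIsCompactDecomposition hm hT hX hY hn⟩, hY⟩

include hC hR hM in
/-- The approximation triangles of bounded objects give the right adjoint of the inclusion. -/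
lemma isRightAdmissibleIn_bounded (hAB : IsContinuousDecomposition A B M R) :
    IsRightAdmissibleIn (coprodClosure A ⊓ (closureOfCompacts R ⊓ unionRightOrthogonal M))
      (closureOfCompacts R ⊓ unionRightOrthogonal M) := by
  have := bounded_isTriangulated hR hM
  have := hAB.isTriangulated₁
  have := coprodClosure_isTriangulated (A := A)
  have : (closureOfCompacts R ⊓ unionRightOrthogonal M).IsClosedUnderIsomorphisms :=
    inferInstance
  have : ObjectProperty.IsClosedUnderIsomorphisms
      (coprodClosure A ⊓ (closureOfCompacts R ⊓ unionRightOrthogonal M)) := ⟨fun e h =>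
    ⟨prop_of_iso _ e h.1, prop_of_iso _ e h.2⟩⟩
  have : ObjectProperty.IsTriangulated
      (coprodClosure A ⊓ (closureOfCompacts R ⊓ unionRightOrthogonal M)) := inferInstance
  refine isRightAdmissibleIn_of_triangles inf_le_right fun F hF => ?_
  obtain ⟨X, Y, f, g, h, hT, hX, hY⟩ := exists_triangle_bounded hC hR hAB hF
  exact ⟨X, Y, f, g, h, hT, hX, fun Z hZ => ⟨fun a =>
    hAB.toIsCompactDecomposition.hom_coprodClosure a hZ.1 hY, fun a =>
    hAB.toIsCompactDecomposition.hom_coprodClosure_shift (-1) a hZ.1 hY⟩⟩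

end BoundedClosure

/-! ### Projections onto admissible subcategories as triangulated endofunctors -/

section Admissible

open ObjectProperty

variable {C : Type u} [Category.{v} C] [HasZeroObject C] [HasShift C ℤ] [Preadditive C]
  [∀ n : ℤ, (shiftFunctor C n).Additive] [Pretriangulated C] {U : ObjectProperty C}

/-- The coreflection onto a right admissible subcategory is a triangulated endofunctor, and the
counit of the adjunction is completed to a triangle by an object right orthogonal to the
subcategory. -/
lemma IsRightAdmissible.exists_endofunctor (hU : IsRightAdmissible U) :
    ∃ (F : C ⥤ C) (_ : F.CommShift ℤ) (_ : F.IsTriangulated), ∀ X, U (F.obj X) ∧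
      ∃ (Y : C) (f : F.obj X ⟶ X) (g : X ⟶ Y) (h : Y ⟶ (F.obj X)⟦(1 : ℤ)⟧),
        Triangle.mk f g h ∈ distTriang C ∧ U.rightOrthogonal Y := by
  have := hU.strict
  have := hU.triangulated
  have := hU.hasRightAdjoint
  let adj := Adjunction.ofIsLeftAdjoint U.ι
  let i := adj.rightAdjointCommShift ℤ
  have := adj.commShift_of_leftAdjoint ℤ
  have := adj.isTriangulated_rightAdjoint
  refine ⟨U.ι.rightAdjoint ⋙ U.ι, inferInstance, inferInstance, fun X =>
    ⟨(U.ι.rightAdjoint.obj X).2, ?_⟩⟩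
  have lift : ∀ {Z} (_ : U Z) (a : Z ⟶ X), ∃ b, a = b ≫ adj.counit.app X := fun hZ a =>
    ⟨((adj.homEquiv ⟨_, hZ⟩ X) a).hom, by
      have := (adj.homEquiv ⟨_, hZ⟩ X).symm_apply_apply a
      rw [adj.homEquiv_counit] at this
      exact this.symm⟩
  have uniq : ∀ {Z} (_ : U Z) (b : Z ⟶ (U.ι.rightAdjoint.obj X).obj),
      b ≫ adj.counit.app X = 0 → b = 0 := fun hZ b hb => by
    have : U.homMk (X := ⟨_, hZ⟩) b = U.homMk 0 := (adj.homEquiv ⟨_, hZ⟩ X).symm.injective (by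
      rw [adj.homEquiv_counit, adj.homEquiv_counit]
      refine hb.trans ?_
      exact zero_comp.symm)
    exact congr_arg InducedCategory.Hom.hom this
  obtain ⟨Y, g, h, hT⟩ := distinguished_cocone_triangle (adj.counit.app X)
  refine ⟨Y, adj.counit.app X, g, h, hT, fun Z a hZ => ?_⟩
  have h0 : a ≫ h = 0 := by
    rw [← cancel_epi (shiftNegShift Z (1 : ℤ)).hom, comp_zero]
    obtain ⟨b, hb⟩ := (shiftFunctor C (1 : ℤ)).map_surjective
      ((shiftNegShift Z (1 : ℤ)).hom ≫ a ≫ h)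
    rw [← hb, uniq (U.le_shift (-1) Z hZ) b, Functor.map_zero]
    refine (shiftFunctor C (1 : ℤ)).map_injective ?_
    rw [Functor.map_comp, hb, Functor.map_zero, Category.assoc, Category.assoc,
      dist_zero₃₁ hT, comp_zero, comp_zero]
  obtain ⟨b, rfl⟩ := dist_lift₃ hT a h0
  obtain ⟨c, rfl⟩ := lift hZ b
  rw [Category.assoc, dist_zero₁₂ hT, comp_zero]

/-- The reflection onto a left admissible subcategory is a triangulated endofunctor, and the
unit of the adjunction is completed to a triangle by an object left orthogonal to the
subcategory. -/
lemma IsLeftAdmissible.exists_endofunctor (hU : IsLeftAdmissible U) :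
    ∃ (F : C ⥤ C) (_ : F.CommShift ℤ) (_ : F.IsTriangulated), ∀ X, U (F.obj X) ∧
      ∃ (Y : C) (f : Y ⟶ X) (g : X ⟶ F.obj X) (h : F.obj X ⟶ Y⟦(1 : ℤ)⟧),
        Triangle.mk f g h ∈ distTriang C ∧ U.leftOrthogonal Y := by
  have := hU.strict
  have := hU.triangulated
  have := hU.hasLeftAdjoint
  let adj := Adjunction.ofIsRightAdjoint U.ι
  let i := adj.leftAdjointCommShift ℤ
  have := adj.commShift_of_rightAdjoint ℤ
  have := adj.isTriangulated_leftAdjoint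
  refine ⟨U.ι.leftAdjoint ⋙ U.ι, inferInstance, inferInstance, fun X =>
    ⟨(U.ι.leftAdjoint.obj X).2, ?_⟩⟩
  have desc : ∀ {Z} (_ : U Z) (a : X ⟶ Z), ∃ b, a = adj.unit.app X ≫ b := fun hZ a =>
    ⟨((adj.homEquiv X ⟨_, hZ⟩).symm a).hom, by
      have := (adj.homEquiv X ⟨_, hZ⟩).apply_symm_apply a
      rw [adj.homEquiv_unit] at this
      exact this.symm⟩
  have uniq : ∀ {Z} (_ : U Z) (b : (U.ι.leftAdjoint.obj X).obj ⟶ Z),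
      adj.unit.app X ≫ b = 0 → b = 0 := fun hZ b hb => by
    have : U.homMk (Y := ⟨_, hZ⟩) b = U.homMk 0 := (adj.homEquiv X ⟨_, hZ⟩).injective (by
      rw [adj.homEquiv_unit, adj.homEquiv_unit]
      refine hb.trans ?_
      exact comp_zero.symm)
    exact congr_arg InducedCategory.Hom.hom this
  obtain ⟨Y, f, h, hT⟩ := distinguished_cocone_triangle₁ (adj.unit.app X)
  refine ⟨Y, f, adj.unit.app X, h, hT, fun Z a hZ => ?_⟩
  have h0 : h ≫ a⟦(1 : ℤ)⟧' = 0 := uniq (U.le_shift 1 Z hZ) _ (by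
    rw [← Category.assoc, dist_zero₂₃ hT, zero_comp])
  obtain ⟨b, hb⟩ := dist_desc₁ hT _ h0
  obtain ⟨b, rfl⟩ := (shiftFunctor C (1 : ℤ)).map_surjective b
  rw [← Functor.map_comp] at hb
  obtain rfl := (shiftFunctor C (1 : ℤ)).map_injective hb
  obtain ⟨c, rfl⟩ := desc hZ b
  rw [← Category.assoc, dist_zero₁₂ hT, zero_comp]

end Admissible

/-! ### Triangles in full subcategories -/

section FullSubcategory

open ObjectProperty

variable {C : Type u} [Category.{v} C] [HasZeroObject C] [HasShift C ℤ] [Preadditive C]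
  [∀ n : ℤ, (shiftFunctor C n).Additive] [Pretriangulated C] {S : ObjectProperty C}
  [S.IsTriangulated]

lemma dist_of_dist_fullSubcategory {X Y Z : S.FullSubcategory} {f : X ⟶ Y} {g : Y ⟶ Z}
    {h : Z ⟶ X⟦(1 : ℤ)⟧} (hT : Triangle.mk f g h ∈ distTriang S.FullSubcategory) :
    Triangle.mk f.hom g.hom (S.ι.map h ≫ (S.ι.commShiftIso (1 : ℤ)).hom.app X) ∈ distTriang C :=
  hT

lemma dist_fullSubcategory_of_dist {X Y Z : S.FullSubcategory} {f : X.obj ⟶ Y.obj}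
    {g : Y.obj ⟶ Z.obj} {h : Z.obj ⟶ X.obj⟦(1 : ℤ)⟧} (hT : Triangle.mk f g h ∈ distTriang C) :
    Triangle.mk (S.homMk f) (S.homMk g)
      (S.fullyFaithfulι.preimage (h ≫ (S.ι.commShiftIso (1 : ℤ)).inv.app X)) ∈
        distTriang S.FullSubcategory :=
  isomorphic_distinguished _ hT _
    (Triangle.isoMk _ (Triangle.mk f g h) (Iso.refl _) (Iso.refl _) (Iso.refl _)
      ((Category.comp_id f).trans (Category.id_comp f).symm)
      ((Category.comp_id g).trans (Category.id_comp g).symm) (by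
        change ((h ≫ (S.ι.commShiftIso (1 : ℤ)).inv.app X) ≫ (S.ι.commShiftIso (1 : ℤ)).hom.app X) ≫
          (𝟙 X.obj)⟦(1 : ℤ)⟧' = 𝟙 Z.obj ≫ h
        simp))

/-- A subcategory of `S` that is strictly full triangulated in `S` is so in the ambient category. -/
lemma isStrictTriangulated_of_inverseImage [S.IsClosedUnderIsomorphisms] {A : ObjectProperty C}
    (hA : A ≤ S) (h : IsStrictTriangulated (A.inverseImage S.ι)) : IsStrictTriangulated A := by
  have := h.triangulated
  have := h.strict
  have : A = (A.inverseImage S.ι).map S.ι := by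
    refine le_antisymm (fun X hX => ⟨⟨X, hA X hX⟩, hX, ⟨Iso.refl _⟩⟩) ?_
    rintro X ⟨Y, hY, ⟨e⟩⟩
    have hX : S X := S.prop_of_iso e Y.2
    exact prop_of_iso (A.inverseImage S.ι) (Y := ⟨X, hX⟩) (S.isoMk e) hY
  rw [this]
  exact ⟨inferInstance, inferInstance⟩

lemma isStrictTriangulated_inverseImage {A : ObjectProperty C} [A.IsTriangulated]
    [A.IsClosedUnderIsomorphisms] : IsStrictTriangulated (A.inverseImage S.ι) :=
  ⟨inferInstance, inferInstance⟩

end FullSubcategory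

/-! ### Continuity of the projections -/

section ContinuousDecomposition

open ObjectProperty

variable {C : Type u} [Category.{v} C] [HasZeroObject C] [HasShift C ℤ] [Preadditive C]
  [∀ n : ℤ, (shiftFunctor C n).Additive] [Pretriangulated C]

/-- The projections of an admissible subcategory of the compact objects are restrictions of
triangulated endofunctors, hence continuous for metrics on which all such functors are. -/
lemma IsAdmissibleIn.isContinuousDecomposition [IsTriangulated C] {A B : ObjectProperty C}
    (hA : IsAdmissibleIn A (compacts C)) [B.IsTriangulated]
    (hAB : ∀ ⦃X Y : C⦄ (f : X ⟶ Y), A X → B Y → f = 0)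
    (hB : compacts C ⊓ A.rightOrthogonal ≤ B) {M R : ℤ → ObjectProperty C}
    (hR : IsCompressedMetric (onCompacts R)) (hMc : ∀ n, M n ≤ compacts C)
    (hM : ∀ (F : (compacts C).FullSubcategory ⥤ (compacts C).FullSubcategory) [F.CommShift ℤ]
      [F.IsTriangulated], ∀ i : ℤ, ∃ n : ℤ, ∀ X, M n X.obj → M i (F.obj X).obj) :
    IsContinuousDecomposition A B M R := by
  obtain ⟨hAc, _, hl, hr⟩ := hA
  obtain ⟨F, _, _, hF⟩ := IsLeftAdmissible.exists_endofunctor hl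
  obtain ⟨G, _, _, hG⟩ := IsRightAdmissible.exists_endofunctor hr
  refine ⟨⟨(isStrictTriangulated_of_inverseImage hAc hl.toIsStrictTriangulated).triangulated,
    inferInstance, hAc, hAB, fun X hX => ?_⟩, fun m => ?_, fun m => ?_⟩
  · obtain ⟨hX', Y, f, g, h, hT, hY⟩ := hG ⟨X, hX⟩
    exact ⟨_, _, _, _, _, dist_of_dist_fullSubcategory hT, hX', hB _ ⟨Y.2, fun Z a hZ =>
      congr_arg InducedCategory.Hom.hom (hY (X := ⟨Z, hAc _ hZ⟩) (homMk a) hZ)⟩⟩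
  · obtain ⟨n, hn⟩ := hR.compressed G m
    refine ⟨n, fun X hX => ?_⟩
    obtain ⟨hX', Y, f, g, h, hT, hY⟩ := hG ⟨X, hX.1⟩
    exact ⟨_, _, _, _, _, dist_of_dist_fullSubcategory hT, ⟨hX', hn ⟨X, hX.1⟩ hX.2⟩,
      hB _ ⟨Y.2, fun Z a hZ =>
        congr_arg InducedCategory.Hom.hom (hY (X := ⟨Z, hAc _ hZ⟩) (homMk a) hZ)⟩⟩
  · obtain ⟨n, hn⟩ := hM F m
    refine ⟨n, fun X hX => ?_⟩
    have hXc := hMc n X hX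
    obtain ⟨hX', Y, f, g, h, hT, hY⟩ := hF ⟨X, hXc⟩
    exact ⟨_, _, _, _, _, dist_of_dist_fullSubcategory hT, ⟨Y.2, fun Z a hZ =>
        congr_arg InducedCategory.Hom.hom (hY (Y := ⟨Z, hAc _ hZ⟩) (homMk a) hZ)⟩,
      ⟨hX', hn ⟨X, hXc⟩ hX⟩⟩

lemma IsSemiorthogonalDecompositionIn.hom_eq_zero {S A B : ObjectProperty C}
    (h : IsSemiorthogonalDecompositionIn ![A, B] S) ⦃X Y : C⦄ (f : X ⟶ Y) (hX : B X) (hY : A Y) :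
    f = 0 := by
  obtain ⟨hle, _, h⟩ := h
  exact congr_arg InducedCategory.Hom.hom (h.hom_eq_zero 1 0 (by simp) (X := ⟨X, hle 1 _ hX⟩)
    (Y := ⟨Y, hle 0 _ hY⟩) (S.homMk f) hX hY)

/-- In a semiorthogonal decomposition `⟨A, B⟩` of `S`, the subcategory `A` is the right orthogonal
of `B`. -/
lemma IsSemiorthogonalDecompositionIn.inf_rightOrthogonal_le [IsTriangulated C]
    {S A B : ObjectProperty C} [S.IsClosedUnderIsomorphisms]
    (h : IsSemiorthogonalDecompositionIn ![A, B] S) : S ⊓ B.rightOrthogonal ≤ A := by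
  obtain ⟨hle, _, h⟩ := h
  have hA : IsStrictTriangulated A :=
    isStrictTriangulated_of_inverseImage (hle 0) (h.strictTriangulated 0)
  have hB : IsStrictTriangulated B :=
    isStrictTriangulated_of_inverseImage (hle 1) (h.strictTriangulated 1)
  obtain ⟨_, _⟩ := hA
  obtain ⟨_, _⟩ := hB
  have hBA := IsSemiorthogonalDecompositionIn.hom_eq_zero ⟨hle, _, h⟩
  have : (extensionProduct B A).IsTriangulated :=
    { exists_zero := ⟨0, isZero_zero C, le_extensionProduct_left A _ B.prop_zero⟩
      toIsStableUnderShift := inferInstance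
      toIsTriangulatedClosed₂ := .mk' fun T hT h₁ h₃ => by
        have := extensionProduct_extensionProduct_le
          (fun X Y f hX hY => hBA f hX (A.le_shift 1 _ hY)) _ ⟨_, _, _, _, _, hT, h₁, h₃⟩
        refine monotone_extensionProduct_left _ ?_ _ (monotone_extensionProduct_right _ ?_ _ this)
        · exact extensionProduct_le_of_isTriangulatedClosed₂ le_rfl le_rfl
        · exact extensionProduct_le_of_isTriangulatedClosed₂ le_rfl le_rfl }
  have top := h.generates ((extensionProduct B A).inverseImage S.ι)
    isStrictTriangulated_inverseImage (by
      intro i X hX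
      fin_cases i
      · exact le_extensionProduct_right B _ hX
      · exact le_extensionProduct_left A _ hX)
  rintro X ⟨hX, hX'⟩
  obtain ⟨Y, Z, f, g, w, hT, hY, hZ⟩ : (extensionProduct B A).inverseImage S.ι ⟨X, hX⟩ := by
    rw [top]; trivial
  have hY0 : IsZero Y := by
    rw [IsZero.iff_id_eq_zero]
    exact eq_zero_of_comp_eq_zero hT (fun a => hBA a hY (A.le_shift (-1) _ hZ)) _
      (by rw [hX' f hY, comp_zero])
  have : IsIso g := (Triangle.isZero₁_iff_isIso₂ _ hT).1 hY0
  exact A.prop_of_iso (asIso g).symm hZ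

/-- A continuous decomposition of the compact objects induces a semiorthogonal decomposition of
the bounded objects in the closure of compacts. -/
lemma isSemiorthogonalDecompositionIn_bounded [IsTriangulated C] (hC : IsCompactlyGenerated C)
    {A B : ObjectProperty C} {M R : ℤ → ObjectProperty C} (hR : IsCompactlyVanishing R)
    (hM : IsShiftFiltration M) (hBA : IsContinuousDecomposition B A M R) :
    IsSemiorthogonalDecompositionIn
      ![coprodClosure A ⊓ (closureOfCompacts R ⊓ unionRightOrthogonal M),
        coprodClosure B ⊓ (closureOfCompacts R ⊓ unionRightOrthogonal M)]
      (closureOfCompacts R ⊓ unionRightOrthogonal M) := by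
  have := bounded_isTriangulated hR hM
  have := hBA.isTriangulated₁
  have := hBA.isTriangulated₂
  have hs : ∀ D : ObjectProperty C, D.IsTriangulated → IsStrictTriangulated (inverseImage
      (coprodClosure D ⊓ (closureOfCompacts R ⊓ unionRightOrthogonal M))
      (closureOfCompacts R ⊓ unionRightOrthogonal M).ι) := by
    intro D _
    have := coprodClosure_isTriangulated (A := D)
    have : ObjectProperty.IsClosedUnderIsomorphisms
        (coprodClosure D ⊓ (closureOfCompacts R ⊓ unionRightOrthogonal M)) := ⟨fun e h =>
      ⟨prop_of_iso _ e h.1, prop_of_iso _ e h.2⟩⟩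
    have : ObjectProperty.IsTriangulated
        (coprodClosure D ⊓ (closureOfCompacts R ⊓ unionRightOrthogonal M)) := inferInstance
    exact isStrictTriangulated_inverseImage
  refine ⟨fun i => by fin_cases i <;> exact inf_le_right, inferInstance, fun i => ?_, ?_, ?_⟩
  · fin_cases i
    · exact hs A inferInstance
    · exact hs B inferInstance
  · intro i j hij X Y f hX hY
    obtain ⟨rfl, rfl⟩ : i = 1 ∧ j = 0 := by fin_cases i <;> fin_cases j <;> simp_all
    exact InducedCategory.hom_ext (hBA.hom_coprodClosure f.hom hX.1 hY.1)
  · rintro P ⟨_, _⟩ hP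
    refine eq_top_iff.2 ?_
    rintro ⟨F, hF⟩ -
    obtain ⟨X, Y, f, g, h, hT, hX, hY⟩ := exists_triangle_bounded hC hR hBA hF
    have hY' : (closureOfCompacts R ⊓ unionRightOrthogonal M) Y :=
      ext_of_isTriangulatedClosed₃ _ _ hT hX.2 hF
    exact P.ext_of_isTriangulatedClosed₂ _ (dist_fullSubcategory_of_dist
      (X := ⟨X, hX.2⟩) (Y := ⟨F, hF⟩) (Z := ⟨Y, hY'⟩) hT)
      (hP 1 _ hX) (hP 0 _ ⟨hY, hY'⟩)

end ContinuousDecomposition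

/-! ### Generating sequences -/

section GeneratingSequence

open ObjectProperty

variable {C : Type u} [Category.{v} C] [HasZeroObject C] [HasShift C ℤ] [Preadditive C]
  [∀ n : ℤ, (shiftFunctor C n).Additive] [Pretriangulated C]

/-- The vanishing condition passes from the generators to everything they generate. -/
lemma IsOrthogonalMetric.isCompactlyVanishing {𝒢 R : ℤ → ObjectProperty C}
    (hR : IsOrthogonalMetric R) (h𝒢 : compacts C ≤ seqSpan 𝒢 Set.univ)
    (h : ∀ n : ℤ, ∃ N : ℤ, ∀ i ≥ N, ∀ ⦃X Y : C⦄ (f : X ⟶ Y), 𝒢 n X → R i Y → f = 0) :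
    IsCompactlyVanishing R := by
  have anti := hR.toIsExtendedGoodMetric.antitone
  refine ⟨hR.toIsExtendedGoodMetric, fun n => ?_, fun X hX => ?_⟩
  · rw [← hR.orthogonal n]
    exact .leftOrthogonal _
  · suffices ∃ N, (R N).leftOrthogonal X by
      obtain ⟨N, hN⟩ := this
      exact ⟨N, fun i hi Y hY f => hN f (anti hi _ hY)⟩
    refine smdCoprod_le (Q := fun X => ∃ N, (R N).leftOrthogonal X) ⟨?_, ?_, ?_⟩ ?_ ?_ X (h𝒢 X hX)
    · rintro X Y e ⟨N, hN⟩
      exact ⟨N, prop_of_iso _ e hN⟩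
    · exact fun hX => ⟨0, fun Y f _ => hX.eq_of_src _ _⟩
    · rintro D hD ⟨N, hN⟩ ⟨N', hN'⟩
      exact ⟨max N N', ext_of_isTriangulatedClosed₂ _ D hD
        (fun Y f hY => hN f (anti (le_max_left _ _) _ hY))
        (fun Y f hY => hN' f (anti (le_max_right _ _) _ hY))⟩
    · rintro X Z r ⟨N, hN⟩
      exact ⟨N, leftOrthogonal_of_retract r hN⟩
    · rintro X ⟨n, -, hX⟩
      obtain ⟨N, hN⟩ := h n
      exact ⟨N, fun Y f hY => hN N le_rfl f hX hY⟩

lemma seqSpan_mono {𝒢 : ℤ → ObjectProperty C} {I J : Set ℤ} (h : I ⊆ J) :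
    seqSpan 𝒢 I ≤ seqSpan 𝒢 J :=
  smdCoprod_le_smdCoprod fun X ⟨i, hi, hX⟩ => le_smdCoprod _ X ⟨i, h hi, hX⟩

lemma metricM_le_compacts {𝒢 : ℤ → ObjectProperty C} (h : ∀ n, 𝒢 n ≤ compacts C) (n : ℤ) :
    metricM 𝒢 n ≤ compacts C :=
  smdCoprod_le_compacts fun X ⟨i, _, hX⟩ => h i X hX

lemma metricM_le_metricR (𝒢 : ℤ → ObjectProperty C) (n : ℤ) : metricM 𝒢 n ≤ metricR 𝒢 n :=
  le_leftOrthogonal_rightOrthogonal _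

lemma smdCoprod_le_shift {P Q : ObjectProperty C} (n : ℤ)
    (h : ∀ X, P X → smdCoprod Q (X⟦n⟧)) : smdCoprod P ≤ (smdCoprod Q).shift n := by
  have hQ := smdCoprod_isExtensionClosed Q
  refine smdCoprod_le ⟨fun e hX => ?_, fun hX => ?_, fun D hD h₁ h₃ => ?_⟩ (fun r hZ => ?_) h
  · exact hQ.of_iso ((shiftFunctor C n).mapIso e) hX
  · exact hQ.of_isZero ((shiftFunctor C n).map_isZero hX)
  · exact hQ.extension _ (Triangle.shift_distinguished D hD n) h₁ h₃
  · exact (ObjectProperty.retractClosure _).prop_of_retract (r.map (shiftFunctor C n)) hZ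

lemma IsGeneratingSequence.isShiftFiltration {𝒢 : ℤ → ObjectProperty C}
    (h : IsGeneratingSequence 𝒢) : IsShiftFiltration (metricM 𝒢) where
  succ_le n := seqSpan_mono (Set.Iic_subset_Iic.2 (by omega))
  shift_one n := smdCoprod_le_shift 1 fun X ⟨i, hi, hX⟩ =>
    seqSpan_mono (fun j hj => by simp only [Set.mem_Iic, Set.mem_Icc] at *; omega) _
      (h.shift_one i X hX)
  shift_neg_one n := smdCoprod_le_shift (-1) fun X ⟨i, hi, hX⟩ =>
    seqSpan_mono (fun j hj => by simp only [Set.mem_Iic, Set.mem_Icc] at *; omega) _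
      (h.shift_neg_one i X hX)

lemma IsNCompressedGeneratingSequence.exists_metricM_le {𝒢 : ℤ → ObjectProperty C}
    (h : IsNCompressedGeneratingSequence 𝒢)
    (F : (compacts C).FullSubcategory ⥤ (compacts C).FullSubcategory) [F.CommShift ℤ]
    [F.IsTriangulated] (i : ℤ) : ∃ n : ℤ, ∀ X, metricM 𝒢 n X.obj → metricM 𝒢 i (F.obj X).obj := by
  obtain ⟨l, hl⟩ := h.nCompressed.compressed F
  obtain ⟨j, hj, -⟩ := h.equivalent i
  exact ⟨i + j + l, fun X hX => hj _ (hl _ X (metricM_le_metricR 𝒢 _ _ hX))⟩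

variable [IsTriangulated C] {𝒢 R : ℤ → ObjectProperty C}
  (h𝒢 : IsNCompressedGeneratingSequence 𝒢) (hC : IsCompactlyGenerated C)
  (hR : IsOrthogonalMetric R) (hR' : IsCompressedMetric (onCompacts R))
  (h : ∀ n : ℤ, ∃ N : ℤ, ∀ i ≥ N, ∀ ⦃X Y : C⦄ (f : X ⟶ Y), 𝒢 n X → R i Y → f = 0)

include h𝒢 hC hR hR' h

lemma isRightAdmissibleIn_boundedClosure {A : ObjectProperty C}
    (hA : IsAdmissibleIn A (compacts C)) :
    IsRightAdmissibleIn (coprodClosure A ⊓ boundedClosure 𝒢 R) (boundedClosure 𝒢 R) := by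
  have hA' : IsStrictTriangulated A := by
    obtain ⟨hAc, _, hl, -⟩ := hA
    exact isStrictTriangulated_of_inverseImage hAc hl.toIsStrictTriangulated
  have := hA'.triangulated
  exact isRightAdmissibleIn_bounded hC (hR.isCompactlyVanishing h𝒢.span_eq.ge h)
    h𝒢.isShiftFiltration (hA.isContinuousDecomposition (B := A.rightOrthogonal)
      (fun X Y f hX hY => hY f hX) inf_le_right hR'
      (metricM_le_compacts h𝒢.le_compacts) h𝒢.exists_metricM_le)

lemma isSemiorthogonalDecompositionIn_boundedClosure {A B : ObjectProperty C}
    (hAB : IsSemiorthogonalDecompositionIn ![A, B] (compacts C))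
    (hB : IsAdmissibleIn B (compacts C)) :
    IsSemiorthogonalDecompositionIn
      ![coprodClosure A ⊓ boundedClosure 𝒢 R, coprodClosure B ⊓ boundedClosure 𝒢 R]
      (boundedClosure 𝒢 R) := by
  have hA : IsStrictTriangulated A := by
    obtain ⟨hle, _, h⟩ := hAB
    exact isStrictTriangulated_of_inverseImage (hle 0) (h.strictTriangulated 0)
  have := hA.triangulated
  exact isSemiorthogonalDecompositionIn_bounded hC
    (hR.isCompactlyVanishing h𝒢.span_eq.ge h) h𝒢.isShiftFiltration
    (hB.isContinuousDecomposition hAB.hom_eq_zero hAB.inf_rightOrthogonal_le hR'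
      (metricM_le_compacts h𝒢.le_compacts) h𝒢.exists_metricM_le)

end GeneratingSequence

/-! ### Metrics from double orthogonals -/

section DoubleOrthogonal

open ObjectProperty

variable {C : Type u} [Category.{v} C] [Preadditive C]

lemma leftOrthogonal_rightOrthogonal_le {P Q : ObjectProperty C} (h : P ≤ Q) :
    P.rightOrthogonal.leftOrthogonal ≤ Q.rightOrthogonal.leftOrthogonal :=
  fun _ hX _ f hY => hX f fun _ g hZ => hY g (h _ hZ)

variable [HasShift C ℤ] [∀ n : ℤ, (shiftFunctor C n).Additive]

lemma leftOrthogonal_rightOrthogonal_shift {P Q : ObjectProperty C} (n : ℤ) (h : P ≤ Q.shift n) :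
    P.rightOrthogonal.leftOrthogonal ≤ Q.rightOrthogonal.leftOrthogonal.shift n := by
  intro X hX Y f hY
  refine (shiftFunctor C (-n)).map_injective ?_
  rw [← cancel_epi (shiftShiftNeg X n).inv, Functor.map_zero, comp_zero]
  exact hX _ (rightOrthogonal_shift (-n) (by simpa using h) hY)

variable [HasZeroObject C] [Pretriangulated C]

lemma IsShiftFiltration.isOrthogonalMetric {M : ℤ → ObjectProperty C} (hM : IsShiftFiltration M) :
    IsOrthogonalMetric fun n => (M n).rightOrthogonal.leftOrthogonal where
  strict _ := inferInstance
  containsZero n := (IsCoprodClosed.leftOrthogonal (M n).rightOrthogonal).containsZero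
  extension n := (IsCoprodClosed.leftOrthogonal (M n).rightOrthogonal).extension
  succ_le n := leftOrthogonal_rightOrthogonal_le (hM.succ_le n)
  shift_one n := leftOrthogonal_rightOrthogonal_shift 1 (hM.shift_one n)
  shift_neg_one n := leftOrthogonal_rightOrthogonal_shift (-1) (hM.shift_neg_one n)
  orthogonal _ := le_antisymm
    (fun _ hX _ f hY => hX f fun _ g hZ => hZ g hY) (le_leftOrthogonal_rightOrthogonal _)

lemma IsExtendedGoodMetric.onCompacts {R : ℤ → ObjectProperty C} (hR : IsExtendedGoodMetric R) :
    IsExtendedGoodMetric (onCompacts R) where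
  strict n := by
    have := hR.strict n
    exact inferInstanceAs ((R n).inverseImage (compacts C).ι).IsClosedUnderIsomorphisms
  containsZero n := by
    have := hR.strict n
    have := hR.containsZero n
    exact ⟨0, isZero_zero _, (R n).prop_of_isZero ((compacts C).ι.map_isZero (isZero_zero _))⟩
  extension n D hD h₁ h₃ := hR.extension n _ ((compacts C).ι.map_distinguished D hD) h₁ h₃
  succ_le n X hX := hR.succ_le n _ hX
  shift_one n X hX := by
    have := hR.strict n
    exact (R n).prop_of_iso (((compacts C).ι.commShiftIso (1 : ℤ)).app X).symm
      (hR.shift_one n _ hX)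
  shift_neg_one n X hX := by
    have := hR.strict n
    exact (R n).prop_of_iso (((compacts C).ι.commShiftIso (-1 : ℤ)).app X).symm
      (hR.shift_neg_one n _ hX)

lemma IsNCompressedMetric.isCompressedMetric {M : ℤ → ObjectProperty C}
    (hM : IsNCompressedMetric M) : IsCompressedMetric M where
  toIsExtendedGoodMetric := hM.toIsExtendedGoodMetric
  compressed F _ _ i := by
    obtain ⟨l, hl⟩ := hM.compressed F
    exact ⟨i + l, hl i⟩

end DoubleOrthogonal

/-! ### A single compact generator -/

section SingleGenerator

open ObjectProperty

variable {C : Type u} [Category.{v} C] [HasShift C ℤ]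

/-- The sequence `𝒢^n = {Σ^{ε n} G}`, where `ε` is a sign. -/
def shiftSeq (ε : ℤˣ) (G : C) (n : ℤ) : ObjectProperty C := .singleton (G⟦ε * n⟧)

lemma seqI_eq (G : C) : seqI G = shiftSeq (-1) G := by
  funext n
  simp [seqI, shiftSeq]

lemma seqII_eq (G : C) : seqII G = shiftSeq 1 G := by
  funext n
  simp [seqII, shiftSeq]

variable [Preadditive C]

lemma IsCompactGenerator.isCompactlyGenerated {G : C} (hG : IsCompactGenerator G) :
    IsCompactlyGenerated C :=
  ⟨hG.1, PUnit, fun _ => G, fun _ => hG.2.1, fun X hX => hG.2.2 X (hX ⟨⟩)⟩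

variable [HasZeroObject C] [∀ n : ℤ, (shiftFunctor C n).Additive] [Pretriangulated C]

variable {G : C} {ε : ℤˣ}

lemma shiftSeq_le_compacts (hG : compacts C G) (n : ℤ) : shiftSeq ε G n ≤ compacts C := by
  rintro X ⟨⟩
  exact compacts_shift hG _

lemma seqSpan_shiftSeq {I : Set ℤ} {n : ℤ} (h : (ε : ℤ) * n ∈ I) :
    seqSpan (shiftSeq ε G) I (G⟦n⟧) :=
  le_smdCoprod _ _ ⟨_, h, by simp [shiftSeq, ← mul_assoc]⟩

lemma seqSpan_shiftSeq_shift {I J : Set ℤ} (k : ℤ) (h : ∀ i ∈ I, i + ε * k ∈ J) :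
    seqSpan (shiftSeq ε G) I ≤ (seqSpan (shiftSeq ε G) J).shift k := by
  refine smdCoprod_le_shift k ?_
  rintro _ ⟨i, hi, ⟨⟩⟩
  refine (smdCoprod_isExtensionClosed _).of_iso ((shiftFunctorAdd C _ k).app G)
    (seqSpan_shiftSeq ?_)
  rw [mul_add, ← mul_assoc, Int.units_coe_mul_self, one_mul]
  exact h i hi

/-- Boundedness can be tested on the shifts of the generator. -/
lemma metricM_rightOrthogonal_iff {n : ℤ} {F : C} :
    (metricM (shiftSeq ε G) n).rightOrthogonal F ↔
      ∀ i : ℤ, ε * i ≤ -n → ∀ f : G⟦i⟧ ⟶ F, f = 0 := by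
  refine ⟨fun h i hi f => h f (seqSpan_shiftSeq hi), fun h => ?_⟩
  rw [metricM, seqSpan, rightOrthogonal_smdCoprod]
  rintro _ f ⟨i, hi, ⟨⟩⟩
  exact h _ (by rwa [← mul_assoc, Int.units_coe_mul_self, one_mul]) f

/-- `exists_factor_of_leftOrthogonal` for the part of the sequence `shiftSeq ε G` indexed by `I`. -/
lemma exists_factor_shiftSeq [IsTriangulated C] (hG : IsCompactGenerator G) {I : Set ℤ} {X Y : C}
    (hX : compacts C X)
    (hY : (seqSpan (shiftSeq ε G) I).rightOrthogonal.leftOrthogonal Y) (f : X ⟶ Y) :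
    ∃ (Z : C) (_ : finiteCoprodClosure (fun X => ∃ i ∈ I, shiftSeq ε G i X) Z) (a : X ⟶ Z)
      (b : Z ⟶ Y), f = a ≫ b := by
  have := hG.1
  have h : (fun X => ∃ i ∈ I, shiftSeq ε G i X) =
      ObjectProperty.ofObj fun i : ULift.{v} I => G⟦(ε : ℤ) * i.down⟧ := by
    funext X
    refine propext ⟨?_, ?_⟩
    · rintro ⟨i, hi, ⟨⟩⟩
      exact ⟨(⟨i, hi⟩ : ULift I)⟩
    · rintro ⟨⟨i, hi⟩⟩
      exact ⟨i, hi, by simp [shiftSeq]⟩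
  rw [seqSpan, rightOrthogonal_smdCoprod, h] at hY
  rw [h]
  exact exists_factor_of_leftOrthogonal (fun i => compacts_shift hG.2.1 _) hY hX f

lemma compacts_inf_leftOrthogonal_seqSpan_le [IsTriangulated C] (hG : IsCompactGenerator G)
    (I : Set ℤ) : compacts C ⊓ (seqSpan (shiftSeq ε G) I).rightOrthogonal.leftOrthogonal ≤
      seqSpan (shiftSeq ε G) I := by
  rintro X ⟨hX, hX'⟩
  obtain ⟨Z, hZ, a, b, hab⟩ := exists_factor_shiftSeq hG hX hX' (𝟙 X)
  exact ⟨Z, hZ, ⟨⟨a, b, hab.symm⟩⟩⟩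

lemma isGeneratingSequence_shiftSeq [IsTriangulated C] (hG : IsCompactGenerator G) :
    IsGeneratingSequence (shiftSeq ε G) where
  le_compacts := shiftSeq_le_compacts hG.2.1
  span_eq := by
    refine le_antisymm (smdCoprod_le_compacts fun X ⟨i, _, hX⟩ =>
      shiftSeq_le_compacts hG.2.1 i X hX) fun X hX => compacts_inf_leftOrthogonal_seqSpan_le hG _ _
        ⟨hX, fun Y f hY => ?_⟩
    exact (hG.2.2 Y fun n g => hY g (seqSpan_shiftSeq trivial)).eq_of_tgt _ _
  le_span n X hX := le_smdCoprod _ _ ⟨n, by simp, hX⟩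
  shift_one n X hX := seqSpan_shiftSeq_shift (I := {n}) 1 (by
    obtain rfl | rfl := Int.units_eq_one_or ε <;> simp <;> omega) _ (le_smdCoprod _ _ ⟨n, rfl, hX⟩)
  shift_neg_one n X hX := seqSpan_shiftSeq_shift (I := {n}) (-1) (by
    obtain rfl | rfl := Int.units_eq_one_or ε <;> simp <;> omega) _ (le_smdCoprod _ _ ⟨n, rfl, hX⟩)

lemma IsGeneratingSequence.exists_seqSpan_Icc {𝒢 : ℤ → ObjectProperty C}
    (h : IsGeneratingSequence 𝒢) {X : C} (hX : compacts C X) :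
    ∃ l : ℕ, seqSpan 𝒢 (Set.Icc (-l) l) X := by
  have mono : ∀ {l m : ℕ}, l ≤ m → seqSpan 𝒢 (Set.Icc (-l) l) ≤ seqSpan 𝒢 (Set.Icc (-m) m) :=
    fun h => seqSpan_mono (Set.Icc_subset_Icc (by omega) (by omega))
  have cl := fun l : ℕ => smdCoprod_isExtensionClosed fun X =>
    ∃ i ∈ Set.Icc (-(l : ℤ)) l, 𝒢 i X
  rw [← h.span_eq] at hX
  refine smdCoprod_le (Q := fun X => ∃ l : ℕ, seqSpan 𝒢 (Set.Icc (-l) l) X)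
    ⟨?_, ?_, ?_⟩ ?_ ?_ X hX
  · rintro X Y e ⟨l, hl⟩
    exact ⟨l, (cl l).of_iso e hl⟩
  · exact fun hX => ⟨0, (cl 0).of_isZero hX⟩
  · rintro D hD ⟨l, hl⟩ ⟨m, hm⟩
    exact ⟨max l m, (cl _).extension D hD (mono (le_max_left _ _) _ hl)
      (mono (le_max_right _ _) _ hm)⟩
  · rintro X Z r ⟨l, hl⟩
    exact ⟨l, (ObjectProperty.retractClosure _).prop_of_retract r hl⟩
  · rintro X ⟨i, -, hX⟩
    exact ⟨i.natAbs, le_smdCoprod _ _ ⟨i, by simp only [Set.mem_Icc]; omega, hX⟩⟩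

/-- A triangulated endofunctor `F` of the compact objects that carries generators into `P` carries
everything they generate into `smdCoprod P`. -/
lemma smdCoprod_obj {P Q : ObjectProperty C}
    (F : (compacts C).FullSubcategory ⥤ (compacts C).FullSubcategory) [F.CommShift ℤ]
    [F.IsTriangulated] (h : ∀ X, P X → ∃ hX : compacts C X, smdCoprod Q (F.obj ⟨X, hX⟩).obj)
    {X : C} (hX : smdCoprod P X) : ∃ hX : compacts C X, smdCoprod Q (F.obj ⟨X, hX⟩).obj := by
  have hQ := smdCoprod_isExtensionClosed Q
  refine smdCoprod_le (Q := fun X => ∃ hX : compacts C X, smdCoprod Q (F.obj ⟨X, hX⟩).obj)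
    ⟨?_, ?_, ?_⟩ ?_ h X hX
  · rintro X Y e ⟨hX, h⟩
    have hY := (compacts C).prop_of_iso e hX
    exact ⟨hY, hQ.of_iso ((F ⋙ (compacts C).ι).mapIso
      ((compacts C).isoMk e : (⟨X, hX⟩ : (compacts C).FullSubcategory) ≅ ⟨Y, hY⟩)) h⟩
  · intro X hX
    refine ⟨compacts_isExtensionClosed.of_isZero hX, hQ.of_isZero ?_⟩
    refine (F ⋙ (compacts C).ι).map_isZero ?_
    rw [IsZero.iff_id_eq_zero]
    exact InducedCategory.hom_ext (hX.eq_of_src _ _)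
  · rintro D hD ⟨h₁, h₁'⟩ ⟨h₃, h₃'⟩
    have h₂ := (compacts C).ext_of_isTriangulatedClosed₂ D hD h₁ h₃
    exact ⟨h₂, hQ.extension _ ((F ⋙ (compacts C).ι).map_distinguished _
      (dist_fullSubcategory_of_dist (X := ⟨D.obj₁, h₁⟩) (Y := ⟨D.obj₂, h₂⟩) (Z := ⟨D.obj₃, h₃⟩)
        hD)) h₁' h₃'⟩
  · rintro X Z r ⟨hZ, h⟩
    have hX := compacts_of_retract r hZ
    let r' : Retract (⟨X, hX⟩ : (compacts C).FullSubcategory) ⟨Z, hZ⟩ :=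
      ⟨homMk r.i, homMk r.r, InducedCategory.hom_ext r.retract⟩
    exact ⟨hX, (ObjectProperty.retractClosure _).prop_of_retract
      (r'.map (F ⋙ (compacts C).ι)) h⟩

/-- The compact objects of the layers `ℛ^𝒢_n` are exactly `ℳ^𝒢_n`. -/
lemma compacts_inf_metricR_le [IsTriangulated C] (hG : IsCompactGenerator G) (n : ℤ) :
    compacts C ⊓ metricR (shiftSeq ε G) n ≤ metricM (shiftSeq ε G) n :=
  compacts_inf_leftOrthogonal_seqSpan_le hG _

/-- If `F(G)` is generated by the `Σ^i G` with `|i| ≤ l`, then `F(Σ^k G)` is generated by the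
`Σ^i G` with `|i - k| ≤ l`, so the loss of `F` is at most `l`. -/
lemma isNCompressedMetric_shiftSeq [IsTriangulated C] (hG : IsCompactGenerator G) :
    IsNCompressedMetric (onCompacts (metricR (shiftSeq ε G))) where
  toIsExtendedGoodMetric := ((isGeneratingSequence_shiftSeq
    hG).isShiftFiltration.isOrthogonalMetric).toIsExtendedGoodMetric.onCompacts
  compressed F _ _ := by
    obtain ⟨l, hl⟩ := (isGeneratingSequence_shiftSeq (ε := ε) hG).exists_seqSpan_Icc
      (F.obj ⟨G, hG.2.1⟩).2
    refine ⟨l, fun i X hX => metricM_le_metricR _ _ _ ?_⟩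
    refine (smdCoprod_obj (Q := fun X => ∃ j ∈ Set.Iic (-i), shiftSeq ε G j X) F ?_
      (compacts_inf_metricR_le hG _ _ ⟨X.2, hX⟩)).2
    rintro _ ⟨j, hj, ⟨⟩⟩
    have hGj := compacts_shift hG.2.1 ((ε : ℤ) * j)
    have e' : (⟨G⟦(ε : ℤ) * j⟧, hGj⟩ : (compacts C).FullSubcategory) ≅ (⟨G, hG.2.1⟩ :
        (compacts C).FullSubcategory)⟦(ε : ℤ) * j⟧ :=
      (compacts C).isoMk (((compacts C).ι.commShiftIso ((ε : ℤ) * j)).app ⟨G, hG.2.1⟩).symm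
    have e : (F.obj ⟨G⟦(ε : ℤ) * j⟧, hGj⟩).obj ≅ (F.obj ⟨G, hG.2.1⟩).obj⟦(ε : ℤ) * j⟧ :=
      (F ⋙ (compacts C).ι).mapIso e' ≪≫
        ((F ⋙ (compacts C).ι).commShiftIso ((ε : ℤ) * j)).app ⟨G, hG.2.1⟩
    refine ⟨hGj, (smdCoprod_isExtensionClosed _).of_iso e.symm
      (seqSpan_shiftSeq_shift _ (fun k hk => ?_) _ hl)⟩
    rw [← mul_assoc, Int.units_coe_mul_self, one_mul]
    simp only [Set.mem_Icc, Set.mem_Iic] at *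
    omega

lemma isNCompressedGeneratingSequence_shiftSeq [IsTriangulated C] (hG : IsCompactGenerator G) :
    IsNCompressedGeneratingSequence (shiftSeq ε G) where
  toIsGeneratingSequence := isGeneratingSequence_shiftSeq hG
  finite n := ⟨{G⟦(ε : ℤ) * n⟧}, Set.finite_singleton _, by
    rintro _ ⟨⟩
    exact ⟨_, rfl, by simp [shiftSeq], ⟨Iso.refl _⟩⟩⟩
  nCompressed := isNCompressedMetric_shiftSeq hG
  equivalent i := ⟨0, by
    simp only [Nat.cast_zero, add_zero, sub_zero]
    exact ⟨fun X hX => compacts_inf_metricR_le hG _ _ ⟨X.2, hX⟩,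
      fun X hX => metricM_le_metricR _ _ _ hX⟩⟩

/-- Maps from a compact object to `ℛ^𝒢_i` factor through finite extensions of the `Σ^{ε j} G` with
`j ≤ -i`. -/
lemma hom_metricR_eq_zero [IsTriangulated C] (hG : IsCompactGenerator G) {N : ℤ}
    (hN : ∀ m ≥ N, ∀ f : G ⟶ G⟦-(ε * m : ℤ)⟧, f = 0) {n i : ℤ} (hi : N - n ≤ i) ⦃X Y : C⦄
    (f : X ⟶ Y) (hX : shiftSeq ε G n X) (hY : metricR (shiftSeq ε G) i Y) : f = 0 := by
  obtain ⟨⟩ := hX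
  have hc : ObjectProperty.singleton (G⟦(ε : ℤ) * n⟧) ≤ compacts C := by
    rintro _ ⟨⟩
    exact compacts_shift hG.2.1 _
  obtain ⟨Z, hZ, a, b, rfl⟩ := exists_factor_shiftSeq hG (compacts_shift hG.2.1 _) hY f
  suffices a = 0 by rw [this, zero_comp]
  refine finiteCoprodClosure_le (IsCoprodClosed.rightOrthogonal hc).isExtensionClosed ?_ Z hZ a
    (by simp)
  rintro _ ⟨j, hj, ⟨⟩⟩ _ g ⟨⟩
  refine (shiftFunctor C (-(ε * n : ℤ))).map_injective ?_
  rw [← cancel_epi (shiftShiftNeg G (ε * n : ℤ)).inv, ← cancel_mono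
    ((shiftFunctorAdd' C (ε * j : ℤ) (-(ε * n : ℤ)) (-(ε * (n - j) : ℤ)) (by ring)).app G).inv,
    Functor.map_zero, comp_zero, zero_comp]
  rw [Set.mem_Iic] at hj
  exact hN (n - j) (by omega) _

variable [IsTriangulated C] (hG : IsCompactGenerator G)

include hG

lemma isCompactlyVanishing_shiftSeq {N : ℤ}
    (hN : ∀ m ≥ N, ∀ f : G ⟶ G⟦-(ε * m : ℤ)⟧, f = 0) :
    IsCompactlyVanishing (metricR (shiftSeq ε G)) :=
  IsOrthogonalMetric.isCompactlyVanishing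
    (isGeneratingSequence_shiftSeq hG).isShiftFiltration.isOrthogonalMetric
    (isGeneratingSequence_shiftSeq (ε := ε) hG).span_eq.ge
    fun n => ⟨N - n, fun _ hi => hom_metricR_eq_zero (ε := ε) hG hN hi⟩

lemma isRightAdmissibleIn_shiftSeq {N : ℤ}
    (hN : ∀ m ≥ N, ∀ f : G ⟶ G⟦-(ε * m : ℤ)⟧, f = 0) {A : ObjectProperty C}
    (hA : IsAdmissibleIn A (compacts C)) :
    IsRightAdmissibleIn
      (coprodClosure A ⊓ boundedClosure (shiftSeq ε G) (metricR (shiftSeq ε G)))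
      (boundedClosure (shiftSeq ε G) (metricR (shiftSeq ε G))) :=
  isRightAdmissibleIn_boundedClosure (isNCompressedGeneratingSequence_shiftSeq hG)
    hG.isCompactlyGenerated
    (isGeneratingSequence_shiftSeq hG).isShiftFiltration.isOrthogonalMetric
    (isNCompressedMetric_shiftSeq hG).isCompressedMetric
    (fun n => ⟨N - n, fun _ hi => hom_metricR_eq_zero (ε := ε) hG hN hi⟩) hA

lemma isSemiorthogonalDecompositionIn_shiftSeq {N : ℤ}
    (hN : ∀ m ≥ N, ∀ f : G ⟶ G⟦-(ε * m : ℤ)⟧, f = 0) {A B : ObjectProperty C}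
    (hAB : IsSemiorthogonalDecompositionIn ![A, B] (compacts C))
    (hB : IsAdmissibleIn B (compacts C)) :
    IsSemiorthogonalDecompositionIn
      ![coprodClosure A ⊓ boundedClosure (shiftSeq ε G) (metricR (shiftSeq ε G)),
        coprodClosure B ⊓ boundedClosure (shiftSeq ε G) (metricR (shiftSeq ε G))]
      (boundedClosure (shiftSeq ε G) (metricR (shiftSeq ε G))) :=
  isSemiorthogonalDecompositionIn_boundedClosure (isNCompressedGeneratingSequence_shiftSeq hG)
    hG.isCompactlyGenerated
    (isGeneratingSequence_shiftSeq hG).isShiftFiltration.isOrthogonalMetric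
    (isNCompressedMetric_shiftSeq hG).isCompressedMetric
    (fun n => ⟨N - n, fun _ hi => hom_metricR_eq_zero (ε := ε) hG hN hi⟩) hAB hB

end SingleGenerator

/-! ### Comparison with the t-structure and the co-t-structure of a generator -/

section Identification

open ObjectProperty

variable {C : Type u} [Category.{v} C] [HasZeroObject C] [HasShift C ℤ] [Preadditive C]
  [∀ n : ℤ, (shiftFunctor C n).Additive] [Pretriangulated C] {G : C}

lemma tAisle_isCoprodClosed (G : C) : IsCoprodClosed (tAisle G) :=
  coprodClosure_isCoprodClosed _

lemma tAisle_le_shift (G : C) {n : ℤ} (hn : 0 ≤ n) : tAisle G ≤ (tAisle G).shift n :=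
  fun _ hX => coprodClosure_shift n (by
    rintro _ ⟨i, hi, rfl⟩
    exact (coprodClosure_isCoprodClosed _).of_iso ((shiftFunctorAdd C i n).app G)
      (.of _ ⟨i + n, by omega, rfl⟩)) hX

lemma tAisle_shift_le_metricR (G : C) (n : ℤ) :
    (tAisle G).shift (-n) ≤ metricR (shiftSeq (-1) G) n := by
  have h : IsCoprodClosed (metricR (shiftSeq (-1) G) n) := .leftOrthogonal _
  intro X hX
  refine h.of_iso (shiftNegShift X n) (coprodClosure_le (h.shift n) ?_ _ hX)
  rintro _ ⟨i, hi, rfl⟩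
  refine h.of_iso ((shiftFunctorAdd C i n).app G) (metricM_le_metricR _ _ _ (seqSpan_shiftSeq ?_))
  simp
  omega

/-- `Σ V_G` is the right orthogonal of the `Σ^i G` with `i ≤ 1`, so `U_G` is a layer of
`metricR`. -/
lemma coTU_eq (G : C) : coTU G = metricR (shiftSeq 1 G) (-1) := by
  have h₀ : coTV G = (seqSpan (shiftSeq 1 G) (Set.Iic 0)).rightOrthogonal := by
    rw [seqSpan, rightOrthogonal_smdCoprod]
    simp [coTV, shiftSeq, eq_comm]
  rw [coTU, metricR, h₀]
  congr 1
  refine le_antisymm (fun F hF => ?_) fun F hF => ?_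
  · refine prop_of_iso _ (shiftNegShift F (1 : ℤ)) (rightOrthogonal_shift 1 ?_ hF)
    exact seqSpan_shiftSeq_shift _ (by intros; simp at *; omega)
  · refine rightOrthogonal_shift (-1) ?_ hF
    exact seqSpan_shiftSeq_shift _ (by intros; simp at *; omega)

lemma coTU_shift_eq (G : C) (n : ℤ) : (coTU G).shift n = metricR (shiftSeq 1 G) (n - 1) := by
  rw [coTU_eq]
  refine le_antisymm (fun X hX => ?_) ?_
  · have h : IsCoprodClosed (metricR (shiftSeq 1 G) (n - 1)) := .leftOrthogonal _
    refine h.of_iso (shiftShiftNeg X n)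
      (leftOrthogonal_rightOrthogonal_shift (-n) ?_ _ hX)
    exact seqSpan_shiftSeq_shift _ (by intros; simp at *; omega)
  · exact leftOrthogonal_rightOrthogonal_shift n
      (seqSpan_shiftSeq_shift _ (by intros; simp at *; omega))

lemma boundedII_eq (G : C) :
    boundedII G = boundedClosure (shiftSeq 1 G) (metricR (shiftSeq 1 G)) := by
  have h : plusCompacts G = closureOfCompacts (metricR (shiftSeq 1 G)) := by
    funext F
    simp only [plusCompacts, closureOfCompacts, coTU_shift_eq]
    exact propext ⟨fun h n => by simpa using h (n + 1), fun h n => h _⟩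
  funext F
  refine propext (and_congr (by rw [h]) ⟨fun ⟨N, hN⟩ => ⟨-N, ?_⟩, fun ⟨n, hn⟩ => ⟨-n, ?_⟩⟩)
  · rw [metricM_rightOrthogonal_iff]
    simpa using hN
  · simpa using metricM_rightOrthogonal_iff.1 hn

variable [IsTriangulated C]

lemma metricM_le_tAisle_shift (hG : IsCompactGenerator G) (n : ℤ) :
    metricM (shiftSeq (-1) G) n ≤ (tAisle G).shift (-n) := by
  have h := (tAisle_isCoprodClosed G).shift (-n)
  have hs : (tAisle G).shift (-n) ≤ ((tAisle G).shift (-n)).shift (1 : ℤ) := fun X hX =>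
    (tAisle_isCoprodClosed G).of_iso ((shiftFunctorComm C (-n) 1).app X)
      (tAisle_le_shift G zero_le_one _ hX)
  refine smdCoprod_le h.isExtensionClosed
    (h.of_retract hG.isCompactlyGenerated hs) ?_
  rintro _ ⟨i, hi, ⟨⟩⟩
  refine (tAisle_isCoprodClosed G).of_iso ((shiftFunctorAdd C _ (-n)).app G) (.of _ ⟨_, ?_, rfl⟩)
  simp at hi ⊢
  omega

/-- The layers `Σ^n T_G^{≤ 0}` are contained in those of `metricR`. For the other inclusion of the
closures of compacts it is enough to compare the compact objects of the layers, since objects of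
the closure are approximated with errors built from these. -/
lemma minusCompacts_eq (hG : IsCompactGenerator G)
    (hR : IsCompactlyVanishing (metricR (shiftSeq (-1) G))) :
    minusCompacts G = closureOfCompacts (metricR (shiftSeq (-1) G)) := by
  refine le_antisymm (fun F hF n =>
    monotone_extensionProduct_right _ (tAisle_shift_le_metricR G n) _ (hF n)) fun F hF n => ?_
  have h := (tAisle_isCoprodClosed G).shift (-n)
  refine monotone_extensionProduct_right _ ?_ _ (extensionProduct_closureOfCompacts hR hF n)
  refine (closureOfCompacts_inf_le hR hG.isCompactlyGenerated h
    ((compacts_inf_metricR_le hG n).trans (metricM_le_tAisle_shift hG n))).trans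
    (extensionProduct_le h le_rfl fun X hX => ?_)
  refine h.of_iso (shiftNegShift X (1 : ℤ)) ?_
  exact (tAisle_isCoprodClosed G).of_iso ((shiftFunctorComm C (-n) 1).app _)
    (tAisle_le_shift G zero_le_one _ hX)

lemma boundedI_eq (hG : IsCompactGenerator G)
    (hR : IsCompactlyVanishing (metricR (shiftSeq (-1) G))) :
    boundedI G = boundedClosure (shiftSeq (-1) G) (metricR (shiftSeq (-1) G)) := by
  funext F
  refine propext (and_congr (by rw [minusCompacts_eq hG hR]) (exists_congr fun n => ?_))
  rw [metricM_rightOrthogonal_iff]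
  simp

end Identification

end TriMetric

open TriMetric in
theorem mainTheorem4 {T : Type u} [Category.{v} T] [HasZeroObject T] [HasShift T ℤ]
    [Preadditive T] [∀ n : ℤ, (shiftFunctor T n).Additive] [Pretriangulated T]
    [IsTriangulated T] :
    -- the general statement, for a generating sequence `𝒢` and an orthogonal metric `R`
    (∀ 𝒢 R : ℤ → ObjectProperty T,
      TriMetric.IsCompactlyGenerated T →
      TriMetric.IsNCompressedGeneratingSequence 𝒢 →
      TriMetric.IsOrthogonalMetric R →
      TriMetric.IsCompressedMetric (TriMetric.onCompacts R) →
      (∀ n : ℤ, ∃ N : ℤ, ∀ i ≥ N, ∀ ⦃X Y : T⦄ (f : X ⟶ Y), 𝒢 n X → R i Y → f = 0) →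
      ∀ A : ObjectProperty T, TriMetric.IsAdmissibleIn A (TriMetric.compacts T) →
        TriMetric.IsRightAdmissibleIn
          (TriMetric.coprodClosure A ⊓ TriMetric.boundedClosure 𝒢 R)
          (TriMetric.boundedClosure 𝒢 R)) ∧
    -- a single compact generator with `Hom(G, Σ^n G) = 0` for `n ≫ 0`
    (∀ G : T, TriMetric.IsCompactGenerator G → TriMetric.HypothesisI G →
      (∀ A : ObjectProperty T, TriMetric.IsAdmissibleIn A (TriMetric.compacts T) →
        TriMetric.IsRightAdmissibleIn
          (TriMetric.coprodClosure A ⊓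
            TriMetric.boundedClosure (TriMetric.seqI G) (TriMetric.metricR (TriMetric.seqI G)))
          (TriMetric.boundedClosure (TriMetric.seqI G)
            (TriMetric.metricR (TriMetric.seqI G)))) ∧
      (∀ A B : ObjectProperty T,
        TriMetric.IsSemiorthogonalDecompositionIn ![A, B] (TriMetric.compacts T) →
        TriMetric.IsAdmissibleIn B (TriMetric.compacts T) →
        TriMetric.IsSemiorthogonalDecompositionIn
          ![TriMetric.coprodClosure A ⊓ TriMetric.boundedI G,
            TriMetric.coprodClosure B ⊓ TriMetric.boundedI G]
          (TriMetric.boundedI G))) ∧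
    -- a single compact generator with `Hom(G, Σ^n G) = 0` for `n ≪ 0`
    (∀ G : T, TriMetric.IsCompactGenerator G → TriMetric.HypothesisII G →
      (∀ A : ObjectProperty T, TriMetric.IsAdmissibleIn A (TriMetric.compacts T) →
        TriMetric.IsRightAdmissibleIn
          (TriMetric.coprodClosure A ⊓
            TriMetric.boundedClosure (TriMetric.seqII G) (TriMetric.metricR (TriMetric.seqII G)))
          (TriMetric.boundedClosure (TriMetric.seqII G)
            (TriMetric.metricR (TriMetric.seqII G)))) ∧
      (∀ A B : ObjectProperty T,
        TriMetric.IsSemiorthogonalDecompositionIn ![A, B] (TriMetric.compacts T) →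
        TriMetric.IsAdmissibleIn B (TriMetric.compacts T) →
        TriMetric.IsSemiorthogonalDecompositionIn
          ![TriMetric.coprodClosure A ⊓ TriMetric.boundedII G,
            TriMetric.coprodClosure B ⊓ TriMetric.boundedII G]
          (TriMetric.boundedII G))) := by
  refine ⟨fun 𝒢 R hT h𝒢 hR hR' h A hA => isRightAdmissibleIn_boundedClosure h𝒢 hT hR hR' h hA,
    fun G hG h => ?_, fun G hG h => ?_⟩
  · obtain ⟨N, hN⟩ := h
    have hN' : ∀ m ≥ N, ∀ f : G ⟶ G⟦-(((-1 : ℤˣ) : ℤ) * m)⟧, f = 0 := fun m hm f =>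
      hN _ (by simpa using hm) f
    rw [boundedI_eq hG (isCompactlyVanishing_shiftSeq hG hN'), seqI_eq]
    exact ⟨fun A hA => isRightAdmissibleIn_shiftSeq hG hN' hA,
      fun A B hAB hB => isSemiorthogonalDecompositionIn_shiftSeq hG hN' hAB hB⟩
  · obtain ⟨N, hN⟩ := h
    have hN' : ∀ m ≥ -N, ∀ f : G ⟶ G⟦-(((1 : ℤˣ) : ℤ) * m)⟧, f = 0 := fun m hm f =>
      hN _ (by simp; omega) f
    rw [boundedII_eq, seqII_eq]
    exact ⟨fun A hA => isRightAdmissibleIn_shiftSeq hG hN' hA,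
      fun A B hAB hB => isSemiorthogonalDecompositionIn_shiftSeq hG hN' hAB hB⟩
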